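/- Let $\mathbb K$ be an algebraically closed field of characteristic zero. A superalgebra is a finite-dimensional, not necessarily unital, $\mathbb Z_2$-graded associative $\mathbb K$-algebra $A=A_{\bar 0}\oplus A_{\bar 1}$ with $A_\alpha A_\beta\subseteq A_{\alpha+\beta}$. An odd-symmetric associative superalgebra $(A,B)$ is a superalgebra with a non-degenerate bilinear form $B$ that is odd ($B(A_{\alpha},A_{\alpha})=0$ for $\alpha\in\mathbb Z_2$), supersymmetric ($B(x,y)=(-1)^{|x||y|}B(y,x)$ for homogeneous $x,y$) and associative ($B(xy,z)=B(x,yz)$). Isomorphisms of odd-symmetric superalgebras are even, multiplicative linear bijections that preserve the forms. $M_{r,s}(\mathbb K)$ is the algebra of $(r+s)\times(r+s)$ matrices, whose even part is the block-diagonal matrices and whose odd part is the block-anti-diagonal ones. $Q_n(\mathbb K)$ is the sub-superalgebra of $M_{n,n}(\mathbb K)$ of all matrices $\begin{pmatrix}a&b\\ b&a\end{pmatrix}$ with $a,b\in M_n(\mathbb K)$. *Generalized double extension.* Let $(W,*,B)$ be an odd-symmetric associative superalgebra and $(V,\star)$ a superalgebra. Let $P(V^*)$ be the dual space $V^*$ with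 shifted grading, $P(V^*)_{\bar 0}=(V^*)_{\bar 1}$ and $P(V^*)_{\bar 1}=(V^*)_{\bar 0}$. Let $\mu:V\to \mathrm{End}(W)$ be an even linear map, and $\lambda:V\times V\to W$ and $\gamma:V\times V\to P(V^*)$ even bilinear maps. Let $\mu(v)^*$ be the adjoint of $\mu(v)$: $B(\mu(v)^*(x),y)=B(x,\mu(v)(y))$. Suppose that for all $x,y\in W$ and $v,v',v'',v'''\in V$: 1. $\mu(v)(x*y)=\mu(v)(x)*y$; 2. $\mu(v)\circ\mu(v')^*=\mu(v')^*\circ\mu(v)$; 3. $\mu(v)(\mu(v')(x))=\lambda(v,v')*x+\mu(v\star v')(x)$; 4. $\lambda(v,v'\star v'')+\mu(v)(\lambda(v',v''))=\mu(v'')^*(\lambda(v,v'))+\lambda(v\star v',v'')$; 5. $\gamma(v,v')(v'')=\gamma(v',v'')(v)$; 6. $\gamma(v\star v',v'')(v''')+\gamma(v,v')(v''\star v''')-\gamma(v,v'\star v'')(v''')-\gamma(v',v'')(v'''\star v)=B(\lambda(v''',v),\lambda(v',v''))-B(\lambda(v,v'),\lambda(v'',v'''))$. The generalized double extension of $W$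 by $V$ by means of $(\mu,\lambda,\gamma)$ is $P(V^*)\oplus W\oplus V$ with the product (for $f,g\in P(V^*)$, $x,y\in W$, $v,v'\in V$) $$(f+x+v)(g+y+v')=\big[f(v'\star\,\cdot\,)+g(\,\cdot\,\star v)+\gamma(v,v')+B(y,\lambda(\,\cdot\,,v))+B(x,\lambda(v',\,\cdot\,))+B(\mu(\,\cdot\,)(x),y)\big]+\big[x*y+\lambda(v,v')+\mu(v)(y)+\mu(v')^*(x)\big]+v\star v'$$ and the form $\widetilde B(f+x+v,\,g+y+v')=B(x,y)+f(v')+g(v)$. It is an odd-symmetric associative superalgebra. **Theorem.** Every odd-symmetric associative superalgebra is, up to isomorphism, obtained from finitely many copies of $\{0\}$ and of the superalgebras $Q_n(\mathbb K)$, $n\ge 1$ (each with some odd-symmetric structure), by a finite (for these superalgebras themselves, possibly empty) sequence of the following operations: - generalized double extensions by $M_{r,s}(\mathbb K)$ ($r\ge1$, $s\ge0$) or by $Q_n(\mathbb K)$ ($n\ge1$); - generalized double extensions by one-dimensional (even or odd) superalgebras with null product; - orthogonal direct sums. -/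

import Mathlib

universe u v w

noncomputable section

namespace OddSym

/-- A finite dimensional associative superalgebra over `K`: a (not necessarily unital) associative
`K`-algebra of finite dimension with a decomposition `A = A₀ ⊕ A₁` into subspaces indexed by
`ZMod 2` such that `Aᵢ Aⱼ ⊆ Aᵢ₊ⱼ`. -/
structure Superalgebra (K : Type u) [Field K] where
  /-- the underlying space -/
  carrier : Type v
  [ring : NonUnitalRing carrier]
  [module : Module K carrier]
  [tower : IsScalarTower K carrier carrier]
  [comm : SMulCommClass K carrier carrier]
  [finite : FiniteDimensional K carrier]
  /-- the homogeneous components -/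
  gr : ZMod 2 → Submodule K carrier
  isCompl : IsCompl (gr 0) (gr 1)
  mul_mem : ∀ (i j : ZMod 2) (x y : carrier), x ∈ gr i → y ∈ gr j → x * y ∈ gr (i + j)

attribute [instance] Superalgebra.ring Superalgebra.module Superalgebra.tower Superalgebra.comm
  Superalgebra.finite

variable {K : Type u} [Field K]

instance : CoeSort (Superalgebra.{u, v} K) (Type v) := ⟨fun A => A.carrier⟩

/-- Two superalgebras are isomorphic: there is an even linear bijection which preserves
products. -/
def Superalgebra.Isomorphic (A : Superalgebra.{u, v} K) (A' : Superalgebra.{u, w} K) : Prop :=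
  ∃ e : A ≃ₗ[K] A', (∀ x y, e (x * y) = e x * e y) ∧ ∀ i x, x ∈ A.gr i ↔ e x ∈ A'.gr i

/-- An odd-symmetric associative superalgebra `(A, B)`: an associative superalgebra with an odd,
supersymmetric, associative, non-degenerate bilinear form. -/
structure OddSymmetricSuperalgebra (K : Type u) [Field K] extends Superalgebra.{u, v} K where
  /-- the bilinear form -/
  form : LinearMap.BilinForm K carrier
  form_odd : ∀ (i j : ZMod 2) (x y : carrier), x ∈ gr i → y ∈ gr j → i + j = 0 → form x y = 0
  form_supersymm : ∀ (i j : ZMod 2) (x y : carrier), x ∈ gr i → y ∈ gr j →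
    form x y = (-1 : K) ^ (i.val * j.val) * form y x
  form_assoc : ∀ x y z : carrier, form (x * y) z = form x (y * z)
  form_nondeg : ∀ x : carrier, (∀ y, form x y = 0) → x = 0

instance : CoeSort (OddSymmetricSuperalgebra.{u, v} K) (Type v) := ⟨fun A => A.carrier⟩

/-- Two odd-symmetric superalgebras are isomorphic: there is an even linear bijection which
preserves products and the bilinear forms. -/
def OddSymmetricSuperalgebra.Isomorphic (A : OddSymmetricSuperalgebra.{u, v} K)
    (A' : OddSymmetricSuperalgebra.{u, w} K) : Prop :=
  ∃ e : A ≃ₗ[K] A', (∀ x y, e (x * y) = e x * e y) ∧ (∀ i x, x ∈ A.gr i ↔ e x ∈ A'.gr i) ∧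
    ∀ x y, A'.form (e x) (e y) = A.form x y

/-! ### The superalgebras `M_{r,s}(K)` and `Q_n(K)` -/

section Matrices

open Matrix

/-- The homogeneous components of `M_{r,s}(K)`: block diagonal matrices in degree `0`, block
anti-diagonal matrices in degree `1`. -/
def matGr (K : Type u) [Field K] (r s : ℕ) (i : ZMod 2) :
    Submodule K (Matrix (Fin r ⊕ Fin s) (Fin r ⊕ Fin s) K) where
  carrier := if i = 0 then {M | M.toBlocks₁₂ = 0 ∧ M.toBlocks₂₁ = 0}
    else {M | M.toBlocks₁₁ = 0 ∧ M.toBlocks₂₂ = 0}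
  zero_mem' := by
    split_ifs <;> exact ⟨rfl, rfl⟩
  add_mem' := by
    intro M N hM hN
    split_ifs at * <;> refine ⟨?_, ?_⟩
    · exact (congrArg₂ (· + ·) hM.1 hN.1).trans (add_zero _)
    · exact (congrArg₂ (· + ·) hM.2 hN.2).trans (add_zero _)
    · exact (congrArg₂ (· + ·) hM.1 hN.1).trans (add_zero _)
    · exact (congrArg₂ (· + ·) hM.2 hN.2).trans (add_zero _)
  smul_mem' := by
    intro c M hM
    split_ifs at * <;> refine ⟨?_, ?_⟩
    · exact (congrArg (c • ·) hM.1).trans (smul_zero _)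
    · exact (congrArg (c • ·) hM.2).trans (smul_zero _)
    · exact (congrArg (c • ·) hM.1).trans (smul_zero _)
    · exact (congrArg (c • ·) hM.2).trans (smul_zero _)

theorem mem_matGr_zero {r s : ℕ} {M : Matrix (Fin r ⊕ Fin s) (Fin r ⊕ Fin s) K} :
    M ∈ matGr K r s 0 ↔ M.toBlocks₁₂ = 0 ∧ M.toBlocks₂₁ = 0 := by
  change M ∈ (if (0 : ZMod 2) = 0 then {M | M.toBlocks₁₂ = 0 ∧ M.toBlocks₂₁ = 0}
    else {M | M.toBlocks₁₁ = 0 ∧ M.toBlocks₂₂ = 0} :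
      Set (Matrix (Fin r ⊕ Fin s) (Fin r ⊕ Fin s) K)) ↔ _
  rw [if_pos rfl]; rfl

theorem mem_matGr_one {r s : ℕ} {M : Matrix (Fin r ⊕ Fin s) (Fin r ⊕ Fin s) K} :
    M ∈ matGr K r s 1 ↔ M.toBlocks₁₁ = 0 ∧ M.toBlocks₂₂ = 0 := by
  change M ∈ (if (1 : ZMod 2) = 0 then {M | M.toBlocks₁₂ = 0 ∧ M.toBlocks₂₁ = 0}
    else {M | M.toBlocks₁₁ = 0 ∧ M.toBlocks₂₂ = 0} :
      Set (Matrix (Fin r ⊕ Fin s) (Fin r ⊕ Fin s) K)) ↔ _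
  rw [if_neg one_ne_zero]; rfl

theorem matGr_mul_mem (r s : ℕ) (i j : ZMod 2) (M N : Matrix (Fin r ⊕ Fin s) (Fin r ⊕ Fin s) K)
    (hM : M ∈ matGr K r s i) (hN : N ∈ matGr K r s j) : M * N ∈ matGr K r s (i + j) := by
  have h : M * N = fromBlocks M.toBlocks₁₁ M.toBlocks₁₂ M.toBlocks₂₁ M.toBlocks₂₂ *
      fromBlocks N.toBlocks₁₁ N.toBlocks₁₂ N.toBlocks₂₁ N.toBlocks₂₂ := by
    rw [fromBlocks_toBlocks, fromBlocks_toBlocks]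
  rw [h, fromBlocks_multiply]
  have h2 : ∀ k : ZMod 2, k = 0 ∨ k = 1 := by decide
  have h3 : (1 : ZMod 2) + 1 = 0 := by decide
  rcases h2 i with rfl | rfl <;> rcases h2 j with rfl | rfl <;>
    simp only [add_zero, zero_add, h3, mem_matGr_zero, mem_matGr_one] at * <;>
    simp [hM.1, hM.2, hN.1, hN.2]

theorem matGr_isCompl (r s : ℕ) : IsCompl (matGr K r s 0) (matGr K r s 1) := by
  constructor
  · rw [Submodule.disjoint_def]
    intro M h0 h1
    rw [mem_matGr_zero] at h0
    rw [mem_matGr_one] at h1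
    rw [← fromBlocks_toBlocks M, h0.1, h0.2, h1.1, h1.2, fromBlocks_zero]
  · rw [codisjoint_iff, Submodule.eq_top_iff']
    intro M
    rw [Submodule.mem_sup]
    refine ⟨fromBlocks M.toBlocks₁₁ 0 0 M.toBlocks₂₂, ?_,
      fromBlocks 0 M.toBlocks₁₂ M.toBlocks₂₁ 0, ?_, ?_⟩
    · simp [mem_matGr_zero]
    · simp [mem_matGr_one]
    · simp [fromBlocks_add, fromBlocks_toBlocks]

/-- The superalgebra `M_{r,s}(K)`. -/
def matSuper (K : Type u) [Field K] (r s : ℕ) : Superalgebra.{u, u} K where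
  carrier := Matrix (Fin r ⊕ Fin s) (Fin r ⊕ Fin s) K
  gr := matGr K r s
  isCompl := matGr_isCompl r s
  mul_mem := matGr_mul_mem r s

/-- The subalgebra of all block matrices `(a b; b a)` with `a`, `b` square matrices of
order `n`. -/
def queerSubalgebra (K : Type u) [Field K] (n : ℕ) :
    NonUnitalSubalgebra K (Matrix (Fin n ⊕ Fin n) (Fin n ⊕ Fin n) K) where
  carrier := {M | ∃ a b : Matrix (Fin n) (Fin n) K, M = fromBlocks a b b a}
  zero_mem' := ⟨0, 0, fromBlocks_zero.symm⟩
  add_mem' := by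
    rintro _ _ ⟨a, b, rfl⟩ ⟨c, d, rfl⟩
    exact ⟨a + c, b + d, fromBlocks_add _ _ _ _ _ _ _ _⟩
  smul_mem' := by
    rintro c _ ⟨a, b, rfl⟩
    exact ⟨c • a, c • b, fromBlocks_smul _ _ _ _ _⟩
  mul_mem' := by
    rintro _ _ ⟨a, b, rfl⟩ ⟨c, d, rfl⟩
    refine ⟨a * c + b * d, a * d + b * c, ?_⟩
    rw [fromBlocks_multiply, add_comm (b * c) (a * d), add_comm (b * d) (a * c)]

/-- The homogeneous components of `Q_n(K)`, induced from `M_{n,n}(K)`. -/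
def queerGr (K : Type u) [Field K] (n : ℕ) (i : ZMod 2) : Submodule K (queerSubalgebra K n) :=
  (matGr K n n i).comap (queerSubalgebra K n).toSubmodule.subtype

theorem queerGr_isCompl (n : ℕ) : IsCompl (queerGr K n 0) (queerGr K n 1) := by
  constructor
  · rw [Submodule.disjoint_def]
    intro M h0 h1
    exact Subtype.ext ((Submodule.disjoint_def.1 (matGr_isCompl n n).disjoint) M.1 h0 h1)
  · rw [codisjoint_iff, Submodule.eq_top_iff']
    rintro ⟨_, a, b, rfl⟩
    rw [Submodule.mem_sup]
    refine ⟨⟨fromBlocks a 0 0 a, a, 0, rfl⟩, mem_matGr_zero.2 ⟨?_, ?_⟩,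
      ⟨fromBlocks 0 b b 0, 0, b, rfl⟩, mem_matGr_one.2 ⟨?_, ?_⟩, Subtype.ext ?_⟩
    · exact toBlocks_fromBlocks₁₂ a 0 0 a
    · exact toBlocks_fromBlocks₂₁ a 0 0 a
    · exact toBlocks_fromBlocks₁₁ 0 b b 0
    · exact toBlocks_fromBlocks₂₂ 0 b b 0
    · change fromBlocks a 0 0 a + fromBlocks 0 b b 0 = fromBlocks a b b a
      rw [fromBlocks_add, add_zero, zero_add]

/-- The superalgebra `Q_n(K)`. -/
def queerSuper (K : Type u) [Field K] (n : ℕ) : Superalgebra.{u, u} K where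
  carrier := queerSubalgebra K n
  finite := FiniteDimensional.finiteDimensional_submodule (queerSubalgebra K n).toSubmodule
  gr := queerGr K n
  isCompl := queerGr_isCompl n
  mul_mem := fun i j x y hx hy => matGr_mul_mem n n i j x.1 y.1 hx hy

end Matrices

/-! ### Basic facts on odd-symmetric superalgebras -/

theorem Superalgebra.exists_add (A : Superalgebra.{u, v} K) (x : A) :
    ∃ x₀ ∈ A.gr 0, ∃ x₁ ∈ A.gr 1, x₀ + x₁ = x :=
  Submodule.mem_sup.1 (A.isCompl.sup_eq_top ▸ Submodule.mem_top)

theorem OddSymmetricSuperalgebra.form_symm (A : OddSymmetricSuperalgebra.{u, v} K) (x y : A) :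
    A.form x y = A.form y x := by
  obtain ⟨x₀, hx₀, x₁, hx₁, rfl⟩ := A.exists_add x
  obtain ⟨y₀, hy₀, y₁, hy₁, rfl⟩ := A.exists_add y
  have h01 := A.form_supersymm 0 1 x₀ y₁ hx₀ hy₁
  have h10 := A.form_supersymm 1 0 x₁ y₀ hx₁ hy₀
  have e1 := A.form_odd 0 0 x₀ y₀ hx₀ hy₀ rfl
  have e2 := A.form_odd 1 1 x₁ y₁ hx₁ hy₁ rfl
  have e3 := A.form_odd 0 0 y₀ x₀ hy₀ hx₀ rfl
  have e4 := A.form_odd 1 1 y₁ x₁ hy₁ hx₁ rfl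
  simp only [ZMod.val_zero, zero_mul, mul_zero, pow_zero, one_mul] at h01 h10
  simp only [map_add, LinearMap.add_apply, e1, e2, e3, e4, h01, h10]
  ring

theorem OddSymmetricSuperalgebra.nondegenerate (A : OddSymmetricSuperalgebra.{u, v} K) :
    A.form.Nondegenerate :=
  ⟨A.form_nondeg, fun y hy => A.form_nondeg y fun x => (A.form_symm y x).trans (hy x)⟩

theorem OddSymmetricSuperalgebra.ext_form (A : OddSymmetricSuperalgebra.{u, v} K) {x y : A}
    (h : ∀ z, A.form x z = A.form y z) : x = y :=
  sub_eq_zero.1 (A.form_nondeg _ fun z => by rw [map_sub, LinearMap.sub_apply, h, sub_self])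

/-- The adjoint `φ^*` of an endomorphism `φ` with respect to the form:
`B (φ^* x, y) = B (x, φ y)`. -/
def OddSymmetricSuperalgebra.adjoint (W : OddSymmetricSuperalgebra.{u, v} K)
    (φ : Module.End K W) : Module.End K W :=
  W.form.leftAdjointOfNondegenerate W.nondegenerate φ

theorem OddSymmetricSuperalgebra.adjoint_left (W : OddSymmetricSuperalgebra.{u, v} K)
    (φ : Module.End K W) (x y : W) : W.form (W.adjoint φ x) y = W.form x (φ y) :=
  W.form.isAdjointPairLeftAdjointOfNondegenerate W.nondegenerate φ x y

theorem OddSymmetricSuperalgebra.adjoint_right (W : OddSymmetricSuperalgebra.{u, v} K)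
    (φ : Module.End K W) (x y : W) : W.form x (W.adjoint φ y) = W.form (φ x) y := by
  rw [W.form_symm, W.adjoint_left, W.form_symm]

/-! ### Orthogonal direct sums -/

/-- The orthogonal direct sum of two odd-symmetric superalgebras. -/
def OddSymmetricSuperalgebra.orthSum (A : OddSymmetricSuperalgebra.{u, v} K)
    (A' : OddSymmetricSuperalgebra.{u, w} K) : OddSymmetricSuperalgebra.{u, max v w} K where
  carrier := A × A'
  gr := fun i => (A.gr i).prod (A'.gr i)
  isCompl := by
    constructor
    · rw [Submodule.disjoint_def]
      intro x h0 h1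
      exact Prod.ext (Submodule.disjoint_def.1 A.isCompl.disjoint _ h0.1 h1.1)
        (Submodule.disjoint_def.1 A'.isCompl.disjoint _ h0.2 h1.2)
    · rw [codisjoint_iff, Submodule.prod_sup_prod, A.isCompl.sup_eq_top, A'.isCompl.sup_eq_top,
        Submodule.prod_top]
  mul_mem := fun i j x y hx hy =>
    ⟨A.mul_mem i j _ _ hx.1 hy.1, A'.mul_mem i j _ _ hx.2 hy.2⟩
  form := A.form.compl₁₂ (LinearMap.fst K A A') (LinearMap.fst K A A') +
    A'.form.compl₁₂ (LinearMap.snd K A A') (LinearMap.snd K A A')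
  form_odd := fun i j x y hx hy h => by
    simp [A.form_odd i j _ _ hx.1 hy.1 h, A'.form_odd i j _ _ hx.2 hy.2 h]
  form_supersymm := fun i j x y hx hy => by
    simp only [LinearMap.add_apply, LinearMap.compl₁₂_apply, LinearMap.fst_apply,
      LinearMap.snd_apply]
    rw [A.form_supersymm i j _ _ hx.1 hy.1, A'.form_supersymm i j _ _ hx.2 hy.2, mul_add]
  form_assoc := fun x y z => by
    simp [A.form_assoc, A'.form_assoc]
  form_nondeg := fun x hx => by
    refine Prod.ext (A.form_nondeg _ fun y => ?_) (A'.form_nondeg _ fun y => ?_)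
    · simpa using hx (y, 0)
    · simpa using hx (0, y)

/-! ### Generalized double extensions -/

/-- The homogeneous component of degree `i` of `P(V^*)`, the dual space of `V` with its
grading shifted: `P(V^*)_0 = (V^*)_1` consists of the forms which vanish on `V_0`, and
`P(V^*)_1 = (V^*)_0` of those which vanish on `V_1`. -/
def parityDualGr (V : Superalgebra.{u, w} K) (i : ZMod 2) : Submodule K (Module.Dual K V) :=
  (V.gr i).dualAnnihilator

/-- A context of generalized double extension of the odd-symmetric superalgebra `W` by the
superalgebra `V`. -/
structure DoubleExtensionContext (W : OddSymmetricSuperalgebra.{u, v} K)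
    (V : Superalgebra.{u, w} K) where
  /-- the even linear map `μ : V → End W` -/
  mu : V →ₗ[K] Module.End K W
  /-- the even bilinear map `λ : V × V → W` -/
  lam : V →ₗ[K] V →ₗ[K] W
  /-- the even bilinear map `γ : V × V → P(V^*)` -/
  gam : V →ₗ[K] V →ₗ[K] Module.Dual K V
  mu_even : ∀ (i j : ZMod 2) (a : V) (x : W), a ∈ V.gr i → x ∈ W.gr j → mu a x ∈ W.gr (i + j)
  lam_even : ∀ (i j : ZMod 2) (a b : V), a ∈ V.gr i → b ∈ V.gr j → lam a b ∈ W.gr (i + j)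
  gam_even : ∀ (i j : ZMod 2) (a b : V), a ∈ V.gr i → b ∈ V.gr j →
    gam a b ∈ parityDualGr V (i + j)
  mu_mul : ∀ (a : V) (x y : W), mu a (x * y) = mu a x * y
  mu_comm : ∀ (a b : V) (x : W), mu a (W.adjoint (mu b) x) = W.adjoint (mu b) (mu a x)
  mu_mu : ∀ (a b : V) (x : W), mu a (mu b x) = lam a b * x + mu (a * b) x
  lam_cocycle : ∀ a b c : V,
    lam a (b * c) + mu a (lam b c) = W.adjoint (mu c) (lam a b) + lam (a * b) c
  gam_cyclic : ∀ a b c : V, gam a b c = gam b c a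
  gam_cocycle : ∀ a b c d : V,
    gam (a * b) c d + gam a b (c * d) - gam a (b * c) d - gam b c (d * a) =
      W.form (lam d a) (lam b c) - W.form (lam a b) (lam c d)

section DoubleExtension

variable {W : OddSymmetricSuperalgebra.{u, v} K} {V : Superalgebra.{u, w} K}

/-- The linear map `v ↦ μ(v)^*`. -/
def DoubleExtensionContext.muStar (c : DoubleExtensionContext W V) : V →ₗ[K] Module.End K W where
  toFun a := W.adjoint (c.mu a)
  map_add' a b := LinearMap.ext fun x => W.ext_form fun z => by
    simp only [LinearMap.add_apply, map_add, W.adjoint_left]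
  map_smul' r a := LinearMap.ext fun x => W.ext_form fun z => by
    simp only [LinearMap.smul_apply, map_smul, W.adjoint_left, RingHom.id_apply]

/-- `ν(v, x)(v') = B(x, λ(v', v))`. -/
def DoubleExtensionContext.nu (c : DoubleExtensionContext W V) (a : V) (x : W) :
    Module.Dual K V := W.form x ∘ₗ c.lam.flip a

/-- `ν'(x, v)(v') = B(x, λ(v, v'))`. -/
def DoubleExtensionContext.nu' (c : DoubleExtensionContext W V) (x : W) (a : V) :
    Module.Dual K V := W.form x ∘ₗ c.lam a

/-- `ψ(x, y)(v) = B(μ(v)(x), y)`. -/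
def DoubleExtensionContext.psi (c : DoubleExtensionContext W V) (x y : W) :
    Module.Dual K V := W.form.flip y ∘ₗ c.mu.flip x

/-- The space `P(V^*) ⊕ W ⊕ V` underlying the generalized double extension of `W` by `V`. -/
def DoubleExtensionContext.Space (_c : DoubleExtensionContext W V) : Type (max u v w) :=
  Module.Dual K V × W × V

instance (c : DoubleExtensionContext W V) : AddCommGroup c.Space :=
  inferInstanceAs (AddCommGroup (Module.Dual K V × W × V))

instance (c : DoubleExtensionContext W V) : Module K c.Space :=
  inferInstanceAs (Module K (Module.Dual K V × W × V))

instance (c : DoubleExtensionContext W V) : FiniteDimensional K c.Space :=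
  inferInstanceAs (FiniteDimensional K (Module.Dual K V × W × V))

/-- The component in `P(V^*)`. -/
def DoubleExtensionContext.Space.dual {c : DoubleExtensionContext W V} (p : c.Space) :
    Module.Dual K V := p.1

/-- The component in `W`. -/
def DoubleExtensionContext.Space.mid {c : DoubleExtensionContext W V} (p : c.Space) : W := p.2.1

/-- The component in `V`. -/
def DoubleExtensionContext.Space.top {c : DoubleExtensionContext W V} (p : c.Space) : V := p.2.2

/-- The element `f + x + a` of `P(V^*) ⊕ W ⊕ V`. -/
def DoubleExtensionContext.mk' (c : DoubleExtensionContext W V) (f : Module.Dual K V) (x : W)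
    (a : V) : c.Space := (f, x, a)

/-- The product of the generalized double extension. Here `v · g = g(_ ⋆ v)` and
`f · v' = f(v' ⋆ _)` for `f`, `g` in `P(V^*)`: the sign `(-1)^{|v||g|}` often written in
`v · g` cancels against the one of the graded right multiplication by `v`. -/
def DoubleExtensionContext.mulFun (c : DoubleExtensionContext W V) (p q : c.Space) : c.Space :=
  c.mk' (p.dual ∘ₗ LinearMap.mulLeft K q.top + q.dual ∘ₗ LinearMap.mulRight K p.top +
      c.gam p.top q.top + c.nu p.top q.mid + c.nu' p.mid q.top + c.psi p.mid q.mid)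
    (p.mid * q.mid + c.lam p.top q.top + c.mu p.top q.mid + c.muStar q.top p.mid)
    (p.top * q.top)

instance (c : DoubleExtensionContext W V) : Mul c.Space := ⟨c.mulFun⟩

namespace DoubleExtensionContext

variable (c : DoubleExtensionContext W V)

theorem space_ext {p q : c.Space} (h1 : ∀ u, p.dual u = q.dual u) (h2 : p.mid = q.mid)
    (h3 : p.top = q.top) : p = q :=
  Prod.ext (LinearMap.ext h1) (Prod.ext h2 h3)

theorem mul_dual (p q : c.Space) (u : V) : (p * q).dual u =
    p.dual (q.top * u) + q.dual (u * p.top) + c.gam p.top q.top u + W.form q.mid (c.lam u p.top) +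
      W.form p.mid (c.lam q.top u) + W.form (c.mu u p.mid) q.mid := rfl

theorem mul_mid (p q : c.Space) : (p * q).mid =
    p.mid * q.mid + c.lam p.top q.top + c.mu p.top q.mid + c.muStar q.top p.mid := rfl

theorem mul_top (p q : c.Space) : (p * q).top = p.top * q.top := rfl

theorem add_dual (p q : c.Space) : (p + q).dual = p.dual + q.dual := rfl
theorem add_mid (p q : c.Space) : (p + q).mid = p.mid + q.mid := rfl
theorem add_top (p q : c.Space) : (p + q).top = p.top + q.top := rfl
theorem smul_dual (r : K) (p : c.Space) : (r • p).dual = r • p.dual := rfl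
theorem smul_mid (r : K) (p : c.Space) : (r • p).mid = r • p.mid := rfl
theorem smul_top (r : K) (p : c.Space) : (r • p).top = r • p.top := rfl
theorem zero_dual : (0 : c.Space).dual = 0 := rfl
theorem zero_mid : (0 : c.Space).mid = 0 := rfl
theorem zero_top : (0 : c.Space).top = 0 := rfl

theorem form_muStar (a : V) (x y : W) : W.form (c.muStar a x) y = W.form x (c.mu a y) :=
  W.adjoint_left _ x y

theorem form_muStar' (a : V) (x y : W) : W.form x (c.muStar a y) = W.form (c.mu a x) y :=
  W.adjoint_right _ x y

theorem muStar_mul_right (a : V) (x y : W) : c.muStar a x * y = x * c.mu a y :=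
  W.ext_form fun z => by
    rw [W.form_assoc, c.form_muStar, c.mu_mul, W.form_assoc]

theorem muStar_mul (a : V) (x y : W) : c.muStar a (x * y) = x * c.muStar a y :=
  W.ext_form fun z => by
    rw [c.form_muStar, W.form_assoc, W.form_assoc, c.muStar_mul_right]

theorem muStar_muStar (a b : V) (x : W) :
    c.muStar b (c.muStar a x) = x * c.lam a b + c.muStar (a * b) x :=
  W.ext_form fun z => by
    rw [c.form_muStar, c.form_muStar, c.mu_mu, map_add, map_add, LinearMap.add_apply,
      c.form_muStar, W.form_assoc]

theorem mul_assoc' (p q r : c.Space) : p * q * r = p * (q * r) := by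
  set f := p.dual
  set x := p.mid
  set a := p.top
  set g := q.dual
  set y := q.mid
  set b := q.top
  set h := r.dual
  set z := r.mid
  set d := r.top
  refine c.space_ext (fun e => ?_) ?_ ?_
  · simp only [mul_dual, mul_mid, mul_top, map_add, LinearMap.add_apply, mul_assoc]
    have e1 := congrArg (W.form x) (c.lam_cocycle b d e)
    have e2 := congrArg (W.form y) (c.lam_cocycle d e a)
    have e3 := congrArg (W.form z) (c.lam_cocycle e a b)
    simp only [map_add, W.adjoint_right] at e1 e2 e3
    have e4 := c.gam_cocycle a b d e
    have e5 : W.form (c.mu e (x * y)) z = W.form (c.mu e x) (y * z) := by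
      rw [c.mu_mul, W.form_assoc]
    have e6 : W.form (c.mu e (c.mu a y)) z =
        W.form (y * z) (c.lam e a) + W.form (c.mu (e * a) y) z := by
      rw [c.mu_mu, map_add, LinearMap.add_apply, W.form_assoc, W.form_symm]
    have e7 : W.form (c.mu e (c.muStar b x)) z = W.form (c.mu e x) (c.mu b z) := by
      have := c.mu_comm e b x
      change c.mu e (c.muStar b x) = c.muStar b (c.mu e x) at this
      rw [this, c.form_muStar]
    have e8 : W.form (c.mu d (c.mu e x)) y =
        W.form (x * y) (c.lam d e) + W.form (c.mu (d * e) x) y := by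
      rw [c.mu_mu, map_add, LinearMap.add_apply, W.form_assoc, W.form_symm]
    have s1 := W.form_symm (c.mu e (c.lam a b)) z
    have s2 := W.form_symm (c.lam e a) (c.lam b d)
    have s3 := c.form_muStar b x (c.lam d e)
    have s4 := c.form_muStar d y (c.lam e a)
    have s5 := c.form_muStar' d (c.mu e x) y
    linear_combination e1 - e2 + e3 + e4 + e5 + e6 + e7 - e8 + s1 + s2 + s3 - s4 - s5
  · simp only [mul_mid, mul_top, map_add, mul_add, add_mul]
    have e1 := c.lam_cocycle a b d
    change _ = c.muStar d (c.lam a b) + _ at e1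
    have e2 := c.mu_comm a d y
    change _ = c.muStar d (c.mu a y) at e2
    change c.mu a (c.muStar d y) = _ at e2
    rw [c.mu_mu, c.mu_mul, c.muStar_mul_right, c.muStar_mul, ← e2, c.muStar_muStar, mul_assoc,
      eq_sub_of_add_eq' e1]
    abel
  · exact mul_assoc a b d

instance : NonUnitalRing c.Space where
  left_distrib p q r := by
    refine c.space_ext (fun u => ?_) ?_ ?_
    · change (p * (q + r)).dual u = (p * q + p * r).dual u
      simp only [mul_dual, add_dual, add_mid, add_top, add_mul, map_add, LinearMap.add_apply]
      abel
    · change (p * (q + r)).mid = (p * q + p * r).mid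
      simp only [mul_mid, add_mid, add_top, mul_add, map_add, LinearMap.add_apply]
      abel
    · exact mul_add p.top q.top r.top
  right_distrib p q r := by
    refine c.space_ext (fun u => ?_) ?_ ?_
    · change ((p + q) * r).dual u = (p * r + q * r).dual u
      simp only [mul_dual, add_dual, add_mid, add_top, mul_add, map_add, LinearMap.add_apply]
      abel
    · change ((p + q) * r).mid = (p * r + q * r).mid
      simp only [mul_mid, add_mid, add_top, add_mul, map_add, LinearMap.add_apply]
      abel
    · exact add_mul p.top q.top r.top
  zero_mul p := by
    refine c.space_ext (fun u => ?_) ?_ ?_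
    · change ((0 : c.Space) * p).dual u = (0 : c.Space).dual u
      simp only [mul_dual, zero_dual, zero_mid, zero_top, mul_zero, map_zero,
        LinearMap.zero_apply, add_zero]
    · change ((0 : c.Space) * p).mid = (0 : c.Space).mid
      simp only [mul_mid, zero_mid, zero_top, zero_mul, map_zero, LinearMap.zero_apply, add_zero]
    · exact zero_mul p.top
  mul_zero p := by
    refine c.space_ext (fun u => ?_) ?_ ?_
    · change (p * (0 : c.Space)).dual u = (0 : c.Space).dual u
      simp only [mul_dual, zero_dual, zero_mid, zero_top, zero_mul, map_zero,
        LinearMap.zero_apply, add_zero]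
    · change (p * (0 : c.Space)).mid = (0 : c.Space).mid
      simp only [mul_mid, zero_mid, zero_top, mul_zero, map_zero, LinearMap.zero_apply, add_zero]
    · exact mul_zero p.top
  mul_assoc := c.mul_assoc'

instance : IsScalarTower K c.Space c.Space where
  smul_assoc k p q := by
    refine c.space_ext (fun u => ?_) ?_ ?_
    · change ((k • p) * q).dual u = (k • (p * q)).dual u
      simp only [mul_dual, smul_dual, smul_mid, smul_top, mul_smul_comm, map_smul,
        LinearMap.smul_apply, smul_add]
    · change ((k • p) * q).mid = (k • (p * q)).mid
      simp only [mul_mid, smul_mid, smul_top, smul_mul_assoc, map_smul, LinearMap.smul_apply,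
        smul_add]
    · exact smul_mul_assoc k p.top q.top

instance : SMulCommClass K c.Space c.Space where
  smul_comm k p q := by
    refine c.space_ext (fun u => ?_) ?_ ?_
    · change (k • (p * q)).dual u = (p * (k • q)).dual u
      simp only [mul_dual, smul_dual, smul_mid, smul_top, smul_mul_assoc, map_smul,
        LinearMap.smul_apply, smul_add]
    · change (k • (p * q)).mid = (p * (k • q)).mid
      simp only [mul_mid, smul_mid, smul_top, mul_smul_comm, map_smul, LinearMap.smul_apply,
        smul_add]
    · exact (mul_smul_comm k p.top q.top).symm

/-- The homogeneous components `P(V^*)_i ⊕ W_i ⊕ V_i`. -/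
def spaceGr (i : ZMod 2) : Submodule K c.Space :=
  (parityDualGr V i).prod ((W.gr i).prod (V.gr i))

theorem mem_spaceGr {i : ZMod 2} {p : c.Space} : p ∈ c.spaceGr i ↔
    (∀ u ∈ V.gr i, p.dual u = 0) ∧ p.mid ∈ W.gr i ∧ p.top ∈ V.gr i :=
  and_congr (Submodule.mem_dualAnnihilator _) Iff.rfl

theorem spaceGr_isCompl : IsCompl (c.spaceGr 0) (c.spaceGr 1) := by
  constructor
  · rw [Submodule.disjoint_def]
    intro p h0 h1
    rw [mem_spaceGr] at h0 h1
    refine c.space_ext (fun u => ?_) (Submodule.disjoint_def.1 W.isCompl.disjoint _ h0.2.1 h1.2.1)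
      (Submodule.disjoint_def.1 V.isCompl.disjoint _ h0.2.2 h1.2.2)
    obtain ⟨u₀, hu₀, u₁, hu₁, rfl⟩ := V.exists_add u
    rw [map_add, h0.1 u₀ hu₀, h1.1 u₁ hu₁, add_zero]
    rfl
  · have h : parityDualGr V 0 ⊔ parityDualGr V 1 = ⊤ := by
      rw [parityDualGr, parityDualGr, ← Subspace.dualAnnihilator_inf_eq, V.isCompl.inf_eq_bot,
        Submodule.dualAnnihilator_bot]
    rw [codisjoint_iff]
    change (parityDualGr V 0).prod ((W.gr 0).prod (V.gr 0)) ⊔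
      (parityDualGr V 1).prod ((W.gr 1).prod (V.gr 1)) = ⊤
    rw [Submodule.prod_sup_prod, Submodule.prod_sup_prod, h, W.isCompl.sup_eq_top,
      V.isCompl.sup_eq_top, Submodule.prod_top, Submodule.prod_top]

theorem muStar_even (i j : ZMod 2) (a : V) (x : W) (ha : a ∈ V.gr i) (hx : x ∈ W.gr j) :
    c.muStar a x ∈ W.gr (i + j) := by
  have h2 : ∀ k : ZMod 2, k + k = 0 := by decide
  have key : ∀ y ∈ W.gr (i + j), W.form (c.muStar a x) y = 0 := fun y hy => by
    rw [c.form_muStar]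
    refine W.form_odd j (i + (i + j)) _ _ hx (c.mu_even _ _ _ _ ha hy) ?_
    rw [← add_assoc i i j, h2, zero_add, h2]
  obtain ⟨w₀, hw₀, w₁, hw₁, hw⟩ := W.exists_add (c.muStar a x)
  have hz : ∀ k : ZMod 2, k = 0 ∨ k = 1 := by decide
  rcases hz (i + j) with h | h <;> rw [h] at key ⊢
  · have : w₁ = 0 := W.form_nondeg _ fun y => by
      obtain ⟨y₀, hy₀, y₁, hy₁, rfl⟩ := W.exists_add y
      have k1 := key y₀ hy₀
      rw [← hw, map_add, LinearMap.add_apply, W.form_odd 0 0 w₀ y₀ hw₀ hy₀ rfl, zero_add] at k1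
      rw [map_add, k1, W.form_odd 1 1 w₁ y₁ hw₁ hy₁ rfl, add_zero]
    rw [← hw, this, add_zero]
    exact hw₀
  · have : w₀ = 0 := W.form_nondeg _ fun y => by
      obtain ⟨y₀, hy₀, y₁, hy₁, rfl⟩ := W.exists_add y
      have k1 := key y₁ hy₁
      rw [← hw, map_add, LinearMap.add_apply, W.form_odd 1 1 w₁ y₁ hw₁ hy₁ rfl, add_zero] at k1
      rw [map_add, k1, W.form_odd 0 0 w₀ y₀ hw₀ hy₀ rfl, add_zero]
    rw [← hw, this, zero_add]
    exact hw₁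

theorem spaceGr_mul_mem (i j : ZMod 2) (p q : c.Space) (hp : p ∈ c.spaceGr i)
    (hq : q ∈ c.spaceGr j) : p * q ∈ c.spaceGr (i + j) := by
  rw [mem_spaceGr] at hp hq ⊢
  obtain ⟨hf, hx, ha⟩ := hp
  obtain ⟨hg, hy, hb⟩ := hq
  have a1 : ∀ i j : ZMod 2, j + (i + j) = i := by decide
  have a2 : ∀ i j : ZMod 2, i + j + i = j := by decide
  have a3 : ∀ i j : ZMod 2, j + (i + j + i) = 0 := by decide
  have a4 : ∀ i j : ZMod 2, i + (j + (i + j)) = 0 := by decide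
  have a5 : ∀ i j : ZMod 2, i + j + i + j = 0 := by decide
  refine ⟨fun u hu => ?_, ?_, ?_⟩
  · rw [mul_dual, hf _ (a1 i j ▸ V.mul_mem _ _ _ _ hb hu),
      hg _ (a2 i j ▸ V.mul_mem _ _ _ _ hu ha),
      (Submodule.mem_dualAnnihilator _).1 (c.gam_even i j _ _ ha hb) u hu,
      W.form_odd _ _ _ _ hy (c.lam_even _ _ _ _ hu ha) (a3 i j),
      W.form_odd _ _ _ _ hx (c.lam_even _ _ _ _ hb hu) (a4 i j),
      W.form_odd _ _ _ _ (c.mu_even _ _ _ _ hu hx) hy (a5 i j)]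
    simp only [add_zero]
  · rw [mul_mid]
    exact add_mem (add_mem (add_mem (W.mul_mem _ _ _ _ hx hy) (c.lam_even _ _ _ _ ha hb))
      (c.mu_even _ _ _ _ ha hy)) (add_comm j i ▸ c.muStar_even _ _ _ _ hb hx)
  · exact V.mul_mem _ _ _ _ ha hb

/-- The bilinear form `B(x, y) + f(v') + g(v)` of the generalized double extension. -/
def spaceForm : LinearMap.BilinForm K c.Space :=
  LinearMap.mk₂ K (fun p q => W.form p.mid q.mid + p.dual q.top + q.dual p.top)
    (fun p q r => by
      simp only [add_dual, add_mid, add_top, map_add, LinearMap.add_apply]; ring)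
    (fun k p q => by
      simp only [smul_dual, smul_mid, smul_top, map_smul, LinearMap.smul_apply, smul_add])
    (fun p q r => by
      simp only [add_dual, add_mid, add_top, map_add, LinearMap.add_apply]; ring)
    (fun k p q => by
      simp only [smul_dual, smul_mid, smul_top, map_smul, LinearMap.smul_apply, smul_add])

theorem spaceForm_apply (p q : c.Space) :
    c.spaceForm p q = W.form p.mid q.mid + p.dual q.top + q.dual p.top := rfl

theorem spaceForm_odd (i j : ZMod 2) (p q : c.Space) (hp : p ∈ c.spaceGr i)
    (hq : q ∈ c.spaceGr j) (h : i + j = 0) : c.spaceForm p q = 0 := by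
  have hij : ∀ i j : ZMod 2, i + j = 0 → i = j := by decide
  obtain rfl := hij i j h
  rw [mem_spaceGr] at hp hq
  rw [spaceForm_apply, W.form_odd i i _ _ hp.2.1 hq.2.1 h, hp.1 _ hq.2.2, hq.1 _ hp.2.2,
    add_zero, add_zero]

theorem spaceForm_symm (p q : c.Space) : c.spaceForm p q = c.spaceForm q p := by
  rw [spaceForm_apply, spaceForm_apply, W.form_symm]
  ring

theorem spaceForm_supersymm (i j : ZMod 2) (p q : c.Space) (hp : p ∈ c.spaceGr i)
    (hq : q ∈ c.spaceGr j) :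
    c.spaceForm p q = (-1 : K) ^ (i.val * j.val) * c.spaceForm q p := by
  have hij : ∀ i j : ZMod 2, i + j = 0 ∨ i.val * j.val = 0 := by decide
  rcases hij i j with h | h
  · rw [c.spaceForm_odd i j p q hp hq h, c.spaceForm_symm, c.spaceForm_odd i j p q hp hq h,
      mul_zero]
  · rw [h, pow_zero, one_mul, c.spaceForm_symm]

theorem spaceForm_assoc (p q r : c.Space) : c.spaceForm (p * q) r = c.spaceForm p (q * r) := by
  simp only [spaceForm_apply, mul_dual, mul_mid, mul_top, map_add, LinearMap.add_apply]
  have s1 := W.form_assoc p.mid q.mid r.mid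
  have s2 := W.form_symm (c.lam p.top q.top) r.mid
  have s3 := c.form_muStar q.top p.mid r.mid
  have s4 := c.gam_cyclic p.top q.top r.top
  have s5 := c.form_muStar' r.top p.mid q.mid
  linear_combination s1 + s2 + s3 + s4 - s5

theorem spaceForm_nondeg (p : c.Space) (h : ∀ q, c.spaceForm p q = 0) : p = 0 := by
  simp only [spaceForm_apply] at h
  refine c.space_ext (fun u => ?_) (W.form_nondeg _ fun y => ?_) ?_
  · have := h (c.mk' 0 0 u)
    change W.form p.mid 0 + p.dual u + 0 = 0 at this
    rwa [map_zero, zero_add, add_zero] at this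
  · have := h (c.mk' 0 y 0)
    change W.form p.mid y + p.dual 0 + 0 = 0 at this
    rwa [map_zero, add_zero, add_zero] at this
  · refine (Module.forall_dual_apply_eq_zero_iff K p.top).1 fun f => ?_
    have := h (c.mk' f 0 0)
    change W.form p.mid 0 + p.dual 0 + f p.top = 0 at this
    rwa [map_zero, map_zero, zero_add, zero_add] at this

/-- The generalized double extension of `W` by `V` by means of the context `c = (μ, λ, γ)`: the
odd-symmetric superalgebra `P(V^*) ⊕ W ⊕ V`. -/
def doubleExtension : OddSymmetricSuperalgebra.{u, max u v w} K where
  carrier := c.Space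
  gr := c.spaceGr
  isCompl := c.spaceGr_isCompl
  mul_mem := c.spaceGr_mul_mem
  form := c.spaceForm
  form_odd := c.spaceForm_odd
  form_supersymm := c.spaceForm_supersymm
  form_assoc := c.spaceForm_assoc
  form_nondeg := c.spaceForm_nondeg

end DoubleExtensionContext
end DoubleExtension

/-- `Obtained A`: up to isomorphism, the odd-symmetric superalgebra `A` is obtained from finitely
many copies of `{0}` and of the superalgebras `Q_n(K)`, `n ≥ 1` (each with some odd-symmetric
structure), by a finite sequence of generalized double extensions by `M_{r,s}(K)`, `r ≥ 1`,
`s ≥ 0`, or by `Q_n(K)`, `n ≥ 1`, generalized double extensions by one-dimensional superalgebras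
with null product, and orthogonal direct sums. -/
inductive Obtained : OddSymmetricSuperalgebra.{u, v} K → Prop
  | zero (A : OddSymmetricSuperalgebra.{u, v} K) (h : ∀ x : A, x = 0) : Obtained A
  | queer (A : OddSymmetricSuperalgebra.{u, v} K) (n : ℕ) (hn : 1 ≤ n)
      (h : A.toSuperalgebra.Isomorphic (queerSuper K n)) : Obtained A
  | extMat (A W : OddSymmetricSuperalgebra.{u, v} K) (r s : ℕ) (hr : 1 ≤ r)
      (c : DoubleExtensionContext W (matSuper K r s)) (hW : Obtained W)
      (h : A.Isomorphic c.doubleExtension) : Obtained A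
  | extQueer (A W : OddSymmetricSuperalgebra.{u, v} K) (n : ℕ) (hn : 1 ≤ n)
      (c : DoubleExtensionContext W (queerSuper K n)) (hW : Obtained W)
      (h : A.Isomorphic c.doubleExtension) : Obtained A
  | extNull (A W : OddSymmetricSuperalgebra.{u, v} K) (V : Superalgebra.{u, u} K)
      (hdim : Module.finrank K V = 1) (hnull : ∀ a b : V, a * b = 0)
      (c : DoubleExtensionContext W V) (hW : Obtained W)
      (h : A.Isomorphic c.doubleExtension) : Obtained A
  | orthSum (A A₁ A₂ : OddSymmetricSuperalgebra.{u, v} K) (h₁ : Obtained A₁) (h₂ : Obtained A₂)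
      (h : A.Isomorphic (A₁.orthSum A₂)) : Obtained A

end OddSym

end

noncomputable section

namespace OddSym

variable {K : Type u} [Field K]

/-! The proof is by induction on dimension. Take a minimal nonzero graded ideal `I` of `A ≠ 0`. By
associativity and oddness of the form, `I^⊥` is again a graded ideal, so by minimality `I ∩ I^⊥` is
`0` or `I`.

If `I ∩ I^⊥ = 0`, then `A` is the orthogonal direct sum of the ideals `I` and `I^⊥`, both smaller
than `A` unless `I = A`. If `I ⊆ I^⊥`, then `A` is the generalized double extension of `I^⊥/I` by
`A/I^⊥`. To see this, choose an even isotropic section of `A → A/I^⊥`; the form identifies `I` with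
the shifted dual of `A/I^⊥`, and the components of products in `A` are `μ`, `λ`, `γ`. The conditions
on them express associativity of `A` and invariance of the form (`Splitting.isomorphic`).

It remains to identify `A/I^⊥`. If `A I = 0`, then `I` is a homogeneous line and `A/I^⊥` is a line
with null product (`exists_map_nullSuper`). Otherwise `A` acts on a minimal graded left ideal `L ⊆
I`, and duality and minimality show that the kernel of this action is `I^⊥` (`exists_map_simple`).
The image is irreducible together with the parity involution of `L`, so it is all of `End L` or the
centralizer of an involution anticommuting with parity (`eq_top_or_exists_centralizer`): these are
`M_{r,s}` and `Q_n`.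

In the case `I = A` the quotient is `A` itself. A null line and `M_{r,s}` are excluded: a
homogeneous space carries no nonzero odd form, and an associative symmetric form on matrices comes
from a functional killing commutators, which oddness forces to vanish. Only `Q_n` is left. -/

theorem OddSymmetricSuperalgebra.form_cyclic (A : OddSymmetricSuperalgebra.{u, v} K) (x y z : A) :
    A.form (x * y) z = A.form (z * x) y := by
  rw [A.form_symm, A.form_assoc]

/-- The homogeneous components are complementary and totally isotropic, so by non-degeneracy each is
its own orthogonal. This is how maps constructed by duality are shown to be even. -/
theorem OddSymmetricSuperalgebra.mem_gr_iff_form (A : OddSymmetricSuperalgebra.{u, v} K)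
    (i : ZMod 2) (x : A) : x ∈ A.gr i ↔ ∀ y ∈ A.gr i, A.form x y = 0 := by
  have h2 : ∀ k : ZMod 2, k + k = 0 := by decide
  refine ⟨fun hx y hy => A.form_odd i i x y hx hy (h2 i), fun key => ?_⟩
  obtain ⟨w₀, hw₀, w₁, hw₁, hw⟩ := A.exists_add x
  have hz : ∀ k : ZMod 2, k = 0 ∨ k = 1 := by decide
  rcases hz i with h | h <;> rw [h] at key ⊢
  · have : w₁ = 0 := A.form_nondeg _ fun y => by
      obtain ⟨y₀, hy₀, y₁, hy₁, rfl⟩ := A.exists_add y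
      have k1 := key y₀ hy₀
      rw [← hw, map_add, LinearMap.add_apply, A.form_odd 0 0 w₀ y₀ hw₀ hy₀ rfl, zero_add] at k1
      rw [map_add, k1, A.form_odd 1 1 w₁ y₁ hw₁ hy₁ rfl, add_zero]
    rw [← hw, this, add_zero]
    exact hw₀
  · have : w₀ = 0 := A.form_nondeg _ fun y => by
      obtain ⟨y₀, hy₀, y₁, hy₁, rfl⟩ := A.exists_add y
      have k1 := key y₁ hy₁
      rw [← hw, map_add, LinearMap.add_apply, A.form_odd 1 1 w₁ y₁ hw₁ hy₁ rfl, add_zero] at k1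
      rw [map_add, k1, A.form_odd 0 0 w₀ y₀ hw₀ hy₀ rfl, add_zero]
    rw [← hw, this, zero_add]
    exact hw₁

/-! ### Splittings, the reduction `I^⊥/I`, and the double extension they give. -/

/-- An even surjection `proj : A → V` of superalgebras together with an even isotropic linear
section `sec` and the embedding `emb` of the dual of `V` as the orthogonal of the kernel, which is
assumed to be contained in the kernel. -/
structure Splitting (A : OddSymmetricSuperalgebra.{u, v} K) (V : Superalgebra.{u, w} K) where
  /-- the projection -/
  proj : A →ₗ[K] V
  /-- the section -/
  sec : V →ₗ[K] A
  /-- the embedding of the dual -/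
  emb : Module.Dual K V →ₗ[K] A
  proj_mul : ∀ x y, proj (x * y) = proj x * proj y
  proj_even : ∀ i x, x ∈ A.gr i → proj x ∈ V.gr i
  sec_even : ∀ i a, a ∈ V.gr i → sec a ∈ A.gr i
  proj_sec : ∀ a, proj (sec a) = a
  form_sec : ∀ a b, A.form (sec a) (sec b) = 0
  form_emb : ∀ f x, A.form (emb f) x = f (proj x)
  proj_emb : ∀ f, proj (emb f) = 0

namespace Splitting

variable {A : OddSymmetricSuperalgebra.{u, v} K} {V : Superalgebra.{u, w} K} (d : Splitting A V)

/-- The component in the dual of `V`. -/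
def dual : A →ₗ[K] Module.Dual K V := A.form.compl₂ d.sec

theorem dual_apply (x : A) (a : V) : d.dual x a = A.form x (d.sec a) := rfl

/-- The projection to the orthogonal of the images of `sec` and `emb`. -/
def mid : A →ₗ[K] A := LinearMap.id - d.sec ∘ₗ d.proj - d.emb ∘ₗ d.dual

theorem mid_apply (x : A) : d.mid x = x - d.sec (d.proj x) - d.emb (d.dual x) := rfl

theorem dual_emb (f : Module.Dual K V) : d.dual (d.emb f) = f :=
  LinearMap.ext fun a => by rw [dual_apply, form_emb, proj_sec]

theorem dual_sec (a : V) : d.dual (d.sec a) = 0 :=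
  LinearMap.ext fun b => d.form_sec a b

theorem proj_mid (x : A) : d.proj (d.mid x) = 0 := by
  rw [mid_apply, map_sub, map_sub, proj_sec, proj_emb, sub_self, sub_zero]

theorem dual_mid (x : A) : d.dual (d.mid x) = 0 := by
  rw [mid_apply, map_sub, map_sub, dual_sec, dual_emb, sub_zero, sub_self]

theorem mid_emb (f : Module.Dual K V) : d.mid (d.emb f) = 0 := by
  rw [mid_apply, proj_emb, dual_emb, map_zero, sub_zero, sub_self]

theorem emb_even (i : ZMod 2) (f : Module.Dual K V) (hf : f ∈ parityDualGr V i) :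
    d.emb f ∈ A.gr i :=
  (A.mem_gr_iff_form i _).2 fun y hy => by
    rw [form_emb]
    exact (Submodule.mem_dualAnnihilator _).1 hf _ (d.proj_even i y hy)

theorem dual_even (i : ZMod 2) (x : A) (hx : x ∈ A.gr i) : d.dual x ∈ parityDualGr V i :=
  (Submodule.mem_dualAnnihilator _).2 fun a ha =>
    (A.mem_gr_iff_form i x).1 hx _ (d.sec_even i a ha)

theorem mid_even (i : ZMod 2) (x : A) (hx : x ∈ A.gr i) : d.mid x ∈ A.gr i :=
  sub_mem (sub_mem hx (d.sec_even i _ (d.proj_even i x hx))) (d.emb_even i _ (d.dual_even i x hx))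

theorem mul_emb (x : A) (f : Module.Dual K V) :
    x * d.emb f = d.emb (f ∘ₗ LinearMap.mulRight K (d.proj x)) :=
  A.ext_form fun z => by
    rw [A.form_symm, ← A.form_assoc, A.form_symm, form_emb, form_emb, proj_mul]
    rfl

theorem emb_mul (x : A) (f : Module.Dual K V) :
    d.emb f * x = d.emb (f ∘ₗ LinearMap.mulLeft K (d.proj x)) :=
  A.ext_form fun z => by
    rw [A.form_assoc, form_emb, form_emb, proj_mul]
    rfl

/-- The image of `emb` is an ideal killed by `mid`, so passing from `y` to its middle component
costs only the section term. With `mid_mid_mul`, this correction produces the `λ` and `μ` terms of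
the context. -/
theorem mid_mul_mid (x y : A) :
    d.mid (x * d.mid y) = d.mid (x * y) - d.mid (x * d.sec (d.proj y)) := by
  rw [d.mid_apply y, mul_sub, mul_sub, map_sub, map_sub, d.mul_emb, d.mid_emb, sub_zero]

theorem mid_mid_mul (x y : A) :
    d.mid (d.mid x * y) = d.mid (x * y) - d.mid (d.sec (d.proj x) * y) := by
  rw [d.mid_apply x, sub_mul, sub_mul, map_sub, map_sub, d.emb_mul, d.mid_emb, sub_zero]

theorem form_mid_left (x y : A) : A.form (d.mid x) y =
    A.form x y - A.form (d.sec (d.proj x)) y - A.form x (d.sec (d.proj y)) := by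
  rw [mid_apply, map_sub, map_sub, LinearMap.sub_apply, LinearMap.sub_apply, form_emb, dual_apply]

/-- In the decomposition into images of `emb`, `mid` and `sec`, the only pairings besides middle
with middle are `emb` with `sec`; the two subtracted terms are these. -/
theorem form_mid_mid (x y : A) : A.form (d.mid x) (d.mid y) =
    A.form x y - A.form (d.sec (d.proj x)) y - A.form x (d.sec (d.proj y)) := by
  rw [form_mid_left, proj_mid, map_zero, map_zero, sub_zero, A.form_symm x, A.form_symm _ (d.mid y),
    form_mid_left, form_mid_left, proj_sec, form_sec, sub_zero, A.form_symm y, A.form_symm y,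
    A.form_symm _ x]
  ring

/-- The orthogonal of the images of `sec` and `emb`. -/
def midSubmodule : Submodule K A := LinearMap.ker d.proj ⊓ LinearMap.ker d.dual

theorem proj_coe (x : d.midSubmodule) : d.proj x = 0 := x.2.1

theorem dual_coe (x : d.midSubmodule) : d.dual x = 0 := x.2.2

theorem mid_coe (x : d.midSubmodule) : d.mid x = x := by
  rw [mid_apply, proj_coe, dual_coe, map_zero, map_zero, sub_zero, sub_zero]

/-- The projection to `midSubmodule`. -/
def toMid : A →ₗ[K] d.midSubmodule :=
  d.mid.codRestrict _ fun x => ⟨d.proj_mid x, d.dual_mid x⟩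

instance : Mul d.midSubmodule := ⟨fun x y => d.toMid (x * y)⟩

theorem coe_mul (x y : d.midSubmodule) : ((x * y : d.midSubmodule) : A) = d.mid (x * y) := rfl

/-- On the kernel of `proj`, which is `I^⊥`, `mid` models the quotient map to `I^⊥/I`. This is what
makes the product on `midSubmodule` associative. -/
theorem mid_mul_mid_of_proj (x : A) {y : A} (hy : d.proj y = 0) :
    d.mid (x * d.mid y) = d.mid (x * y) := by
  rw [mid_mul_mid, hy, map_zero, mul_zero, map_zero, sub_zero]

theorem mid_mid_mul_of_proj {x : A} (hx : d.proj x = 0) (y : A) :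
    d.mid (d.mid x * y) = d.mid (x * y) := by
  rw [mid_mid_mul, hx, map_zero, zero_mul, map_zero, sub_zero]

theorem proj_mul_coe (x : A) (y : d.midSubmodule) : d.proj (x * y) = 0 := by
  rw [proj_mul, proj_coe, mul_zero]

theorem proj_coe_mul (x : d.midSubmodule) (y : A) : d.proj (x * y) = 0 := by
  rw [proj_mul, proj_coe, zero_mul]

instance : NonUnitalRing d.midSubmodule where
  left_distrib x y z := Subtype.ext <| by
    simp only [coe_mul, Submodule.coe_add, mul_add, map_add]
  right_distrib x y z := Subtype.ext <| by
    simp only [coe_mul, Submodule.coe_add, add_mul, map_add]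
  zero_mul x := Subtype.ext <| by
    simp only [coe_mul, Submodule.coe_zero, zero_mul, map_zero]
  mul_zero x := Subtype.ext <| by
    simp only [coe_mul, Submodule.coe_zero, mul_zero, map_zero]
  mul_assoc x y z := Subtype.ext <| by
    rw [coe_mul, coe_mul, coe_mul, coe_mul, d.mid_mid_mul_of_proj (d.proj_coe_mul x y),
      d.mid_mul_mid_of_proj _ (d.proj_coe_mul y z), mul_assoc]

/-- The odd-symmetric superalgebra `midSubmodule`, a model of `I^⊥ / I` where `I` is the image of
`emb`. -/
def reduction : OddSymmetricSuperalgebra.{u, v} K where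
  carrier := d.midSubmodule
  tower := ⟨fun k x y => Subtype.ext <| by
    change d.mid (k • (x : A) * y) = k • d.mid (x * y)
    rw [smul_mul_assoc, map_smul]⟩
  comm := ⟨fun k x y => Subtype.ext <| by
    change k • d.mid (x * y) = d.mid (x * k • (y : A))
    rw [mul_smul_comm, map_smul]⟩
  gr i := (A.gr i).comap d.midSubmodule.subtype
  isCompl := by
    constructor
    · rw [Submodule.disjoint_def]
      exact fun x h0 h1 => Subtype.ext (Submodule.disjoint_def.1 A.isCompl.disjoint _ h0 h1)
    · rw [codisjoint_iff, Submodule.eq_top_iff']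
      intro x
      obtain ⟨x₀, h₀, x₁, h₁, hx⟩ := A.exists_add x
      refine Submodule.mem_sup.2 ⟨d.toMid x₀, d.mid_even 0 _ h₀, d.toMid x₁, d.mid_even 1 _ h₁, ?_⟩
      rw [← map_add, hx]
      exact Subtype.ext (d.mid_coe x)
  mul_mem i j x y hx hy := d.mid_even _ _ (A.mul_mem i j _ _ hx hy)
  form := A.form.compl₁₂ d.midSubmodule.subtype d.midSubmodule.subtype
  form_odd i j x y hx hy h := A.form_odd i j _ _ hx hy h
  form_supersymm i j x y hx hy := A.form_supersymm i j _ _ hx hy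
  form_assoc x y z := by
    change A.form (d.mid (x * y)) z = A.form x (d.mid (y * z))
    rw [A.form_symm x, form_mid_left, form_mid_left, proj_coe_mul, proj_coe_mul, proj_coe,
      proj_coe]
    simp only [map_zero, sub_zero, LinearMap.zero_apply]
    rw [A.form_assoc, A.form_symm x]
  form_nondeg x hx := Subtype.ext <| A.form_nondeg _ fun y => by
    -- An element of `midSubmodule` is orthogonal to the images of `sec` and `emb`, so its pairing
    -- with `y` is its pairing with the middle component of `y`.
    have := hx (d.toMid y)
    change A.form x (d.mid y) = 0 at this
    rw [A.form_symm, form_mid_left, proj_coe, map_zero, map_zero, sub_zero, A.form_symm,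
      A.form_symm _ (x : A), ← dual_apply, dual_coe, LinearMap.zero_apply, sub_zero] at this
    exact this

/-- The inclusion of the reduction. -/
def val : d.reduction →ₗ[K] A := d.midSubmodule.subtype

/-- The projection to the reduction. -/
def toReduction : A →ₗ[K] d.reduction := d.toMid

theorem val_injective : Function.Injective d.val := Subtype.val_injective

theorem val_toReduction (x : A) : d.val (d.toReduction x) = d.mid x := rfl

theorem val_mul (x y : d.reduction) : d.val (x * y) = d.mid (d.val x * d.val y) := rfl

theorem form_reduction (x y : d.reduction) :
    d.reduction.form x y = A.form (d.val x) (d.val y) := rfl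

theorem proj_val (x : d.reduction) : d.proj (d.val x) = 0 := d.proj_coe x

theorem dual_val (x : d.reduction) : d.dual (d.val x) = 0 := d.dual_coe x

theorem proj_mul_val (x : A) (y : d.reduction) : d.proj (x * d.val y) = 0 := d.proj_mul_coe x y

theorem proj_val_mul (x : d.reduction) (y : A) : d.proj (d.val x * y) = 0 := d.proj_coe_mul x y

/-- The map `μ(a)(x)`, the middle component of `sec a * x`. -/
def mu : V →ₗ[K] Module.End K d.reduction :=
  ((LinearMap.mul K A).compl₁₂ d.sec d.val).compr₂ d.toReduction

theorem val_mu (a : V) (x : d.reduction) : d.val (d.mu a x) = d.mid (d.sec a * d.val x) := rfl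

/-- The map `λ(a, b)`, the middle component of `sec a * sec b`. -/
def lam : V →ₗ[K] V →ₗ[K] d.reduction :=
  ((LinearMap.mul K A).compl₁₂ d.sec d.sec).compr₂ d.toReduction

theorem val_lam (a b : V) : d.val (d.lam a b) = d.mid (d.sec a * d.sec b) := rfl

/-- The map `γ(a, b)`, the dual component of `sec a * sec b`. -/
def gam : V →ₗ[K] V →ₗ[K] Module.Dual K V :=
  ((LinearMap.mul K A).compl₁₂ d.sec d.sec).compr₂ d.dual

theorem gam_apply (a b e : V) : d.gam a b e = A.form (d.sec a * d.sec b) (d.sec e) := rfl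

/-- By cyclic invariance of the form, left and right multiplication by `sec a` are adjoint. Hence
`μ` alone encodes both actions of the section on the reduction. -/
theorem adjoint_mu (a : V) (x : d.reduction) :
    d.reduction.adjoint (d.mu a) x = d.toReduction (d.val x * d.sec a) :=
  d.reduction.ext_form fun z => by
    rw [d.reduction.adjoint_left, form_reduction, form_reduction, val_mu, val_toReduction,
      A.form_symm (d.val x), form_mid_left, form_mid_left, proj_val_mul, proj_mul_val, proj_val,
      proj_val]
    simp only [map_zero, sub_zero, LinearMap.zero_apply]
    exact A.form_cyclic _ _ _

theorem val_adjoint_mu (a : V) (x : d.reduction) :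
    d.val (d.reduction.adjoint (d.mu a) x) = d.mid (d.val x * d.sec a) := by
  rw [adjoint_mu, val_toReduction]

theorem proj_sec_mul_sec (a b : V) : d.proj (d.sec a * d.sec b) = a * b := by
  rw [proj_mul, proj_sec, proj_sec]

/-- The context of generalized double extension defined by a splitting. -/
def context : DoubleExtensionContext d.reduction V where
  mu := d.mu
  lam := d.lam
  gam := d.gam
  mu_even i j a x ha hx := d.mid_even _ _ (A.mul_mem i j _ _ (d.sec_even i a ha) hx)
  lam_even i j a b ha hb :=
    d.mid_even _ _ (A.mul_mem i j _ _ (d.sec_even i a ha) (d.sec_even j b hb))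
  gam_even i j a b ha hb :=
    d.dual_even _ _ (A.mul_mem i j _ _ (d.sec_even i a ha) (d.sec_even j b hb))
  -- The four conditions on `μ` and `λ` are the middle components of associativity in `A`, for
  -- triples taken from the section and the reduction.
  mu_mul a x y := d.val_injective <| by
    rw [val_mu, val_mul, val_mul, val_mu, d.mid_mul_mid_of_proj _ (d.proj_val_mul x _),
      d.mid_mid_mul_of_proj (d.proj_mul_val _ x), mul_assoc]
  mu_comm a b x := d.val_injective <| by
    rw [val_mu, val_adjoint_mu, val_adjoint_mu, val_mu,
      d.mid_mul_mid_of_proj _ (d.proj_val_mul x _), d.mid_mid_mul_of_proj (d.proj_mul_val _ x),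
      mul_assoc]
  mu_mu a b x := d.val_injective <| by
    rw [map_add, val_mu, val_mu, val_mul, val_lam, val_mu,
      d.mid_mul_mid_of_proj _ (d.proj_mul_val _ x), d.mid_mid_mul, d.proj_sec_mul_sec, mul_assoc,
      sub_add_cancel]
  lam_cocycle a b c := d.val_injective <| by
    rw [map_add, map_add, val_lam, val_mu, val_lam, val_adjoint_mu, val_lam, val_lam,
      d.mid_mul_mid, d.mid_mid_mul, d.proj_sec_mul_sec, d.proj_sec_mul_sec, mul_assoc]
    abel
  gam_cyclic a b c := by
    rw [gam_apply, gam_apply, A.form_cyclic, A.form_cyclic]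
  gam_cocycle a b c e := by
    simp only [gam_apply, form_reduction, val_lam, form_mid_mid, d.proj_sec_mul_sec]
    -- The section terms of `form_mid_mid` are the four `γ` terms (`e1`, `e2`, `e3` and one match on
    -- the nose). The remaining terms cancel by `e4`, which is cyclic invariance of the product of
    -- four section elements.
    have e1 := A.form_assoc (d.sec (a * b)) (d.sec c) (d.sec e)
    have e2 := A.form_cyclic (d.sec a) (d.sec (b * c)) (d.sec e)
    have e3 := A.form_symm (d.sec b * d.sec c) (d.sec (e * a))
    have e4 : A.form (d.sec e * d.sec a) (d.sec b * d.sec c) =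
        A.form (d.sec a * d.sec b) (d.sec c * d.sec e) := by
      rw [← A.form_cyclic, ← mul_assoc, A.form_assoc]
    linear_combination e1 - e2 - e3 - e4

/-- The linear isomorphism of `A` with the generalized double extension. -/
def equiv : A ≃ₗ[K] d.context.Space where
  toFun x := d.context.mk' (d.dual x) (d.toReduction x) (d.proj x)
  map_add' x y := by
    rw [map_add, map_add, map_add]; rfl
  map_smul' k x := by
    rw [map_smul, map_smul, map_smul]; rfl
  invFun p := d.emb p.dual + d.val p.mid + d.sec p.top
  left_inv x := by
    change d.emb (d.dual x) + d.mid x + d.sec (d.proj x) = x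
    rw [mid_apply]
    abel
  right_inv p := by
    have hp : d.proj (d.emb p.dual + d.val p.mid + d.sec p.top) = p.top := by
      rw [map_add, map_add, proj_emb, proj_val, proj_sec, zero_add, zero_add]
    have hd : d.dual (d.emb p.dual + d.val p.mid + d.sec p.top) = p.dual := by
      rw [map_add, map_add, dual_emb, dual_val, dual_sec, add_zero, add_zero]
    refine d.context.space_ext (fun a => congrArg (· a) hd) (d.val_injective ?_) hp
    change d.mid _ = d.val p.mid
    rw [mid_apply, hp, hd, add_sub_cancel_right, add_sub_cancel_left]

/-- The context was read off from the components of products in `A`, so expanding both factors gives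
back the product of the double extension. Only associativity and cyclic invariance of the form are
needed to match the dual components. -/
theorem isomorphic : A.Isomorphic d.context.doubleExtension := by
  refine ⟨d.equiv, fun x y => ?_, fun i x => ?_, fun x y => ?_⟩
  · refine d.context.space_ext (fun a => ?_) (d.val_injective ?_) (d.proj_mul x y)
    · change A.form (x * y) (d.sec a) = A.form x (d.sec (d.proj y * a)) +
        A.form y (d.sec (a * d.proj x)) +
        A.form (d.sec (d.proj x) * d.sec (d.proj y)) (d.sec a) +
        A.form (d.mid y) (d.mid (d.sec a * d.sec (d.proj x))) +
        A.form (d.mid x) (d.mid (d.sec (d.proj y) * d.sec a)) +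
        A.form (d.mid (d.sec a * d.mid x)) (d.mid y)
      rw [form_mid_mid, form_mid_mid, form_mid_mid, proj_sec_mul_sec, proj_sec_mul_sec,
        proj_mul, proj_mid, mul_zero, map_zero, map_zero, LinearMap.zero_apply]
      rw [← A.form_cyclic (d.mid x) y, ← A.form_cyclic (d.mid x) (d.sec (d.proj y)),
        A.form_assoc (d.mid x), A.form_assoc (d.mid x), form_mid_left,
        form_mid_left, proj_mul, proj_sec_mul_sec, proj_sec]
      have e1 := A.form_assoc x y (d.sec a)
      have e2 := A.form_symm y (d.sec a * d.sec (d.proj x))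
      have e3 := A.form_cyclic (d.sec (d.proj x)) y (d.sec a)
      have e4 := A.form_assoc (d.sec (d.proj x)) y (d.sec a)
      have e5 := A.form_cyclic (d.sec (d.proj x)) (d.sec (d.proj y)) (d.sec a)
      have e6 := A.form_symm (d.sec (d.proj y)) (d.sec a * d.sec (d.proj x))
      linear_combination e1 - e2 + e3 - e4 - e5 + e6
    · change d.mid (x * y) = d.mid (d.mid x * d.mid y) +
        d.mid (d.sec (d.proj x) * d.sec (d.proj y)) + d.mid (d.sec (d.proj x) * d.mid y) +
        d.val (d.reduction.adjoint (d.mu (d.proj y)) (d.toReduction x))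
      rw [val_adjoint_mu, val_toReduction, mid_mul_mid, mid_mul_mid, mid_mid_mul]
      abel
  · change _ ↔ d.equiv x ∈ d.context.spaceGr i
    rw [d.context.mem_spaceGr]
    refine ⟨fun h => ⟨(Submodule.mem_dualAnnihilator _).1 (d.dual_even i x h), d.mid_even i x h,
      d.proj_even i x h⟩, fun h => ?_⟩
    have hx := d.equiv.left_inv x
    change d.emb (d.equiv x).dual + d.val (d.equiv x).mid + d.sec (d.equiv x).top = x at hx
    rw [← hx]
    exact add_mem (add_mem (d.emb_even i _ ((Submodule.mem_dualAnnihilator _).2 h.1)) h.2.1)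
      (d.sec_even i _ h.2.2)
  · change A.form (d.mid x) (d.mid y) + A.form x (d.sec (d.proj y)) +
      A.form y (d.sec (d.proj x)) = A.form x y
    rw [form_mid_mid, A.form_symm y]
    ring

theorem finrank_reduction_lt (hV : 0 < Module.finrank K V) :
    Module.finrank K d.reduction < Module.finrank K A := by
  rw [d.equiv.finrank_eq]
  have : Module.finrank K d.context.Space = Module.finrank K (Module.Dual K V) +
    (Module.finrank K d.reduction + Module.finrank K V) :=
    (Module.finrank_prod (R := K) (M := Module.Dual K V) (M' := d.reduction × V)).trans
      (congrArg _ Module.finrank_prod)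
  omega

end Splitting

/-! ### The grading as an involution. -/

namespace Superalgebra

variable (A : Superalgebra.{u, v} K)

/-- The parity automorphism: the identity on the even part, minus the identity on the odd part. -/
def parity : A →ₗ[K] A :=
  (A.gr 0).projection (A.gr 1) A.isCompl + (A.gr 0).projection (A.gr 1) A.isCompl - LinearMap.id

theorem parity_of_mem_zero {x : A} (hx : x ∈ A.gr 0) : A.parity x = x := by
  have h := Submodule.projection_apply_of_mem_left A.isCompl hx
  change (A.gr 0).projection _ A.isCompl x + (A.gr 0).projection _ A.isCompl x - x = x
  rw [h, add_sub_cancel_right]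

theorem parity_of_mem_one {x : A} (hx : x ∈ A.gr 1) : A.parity x = -x := by
  have h := (Submodule.projection_apply_eq_zero_iff A.isCompl).2 hx
  change (A.gr 0).projection _ A.isCompl x + (A.gr 0).projection _ A.isCompl x - x = -x
  rw [h, add_zero, zero_sub]

theorem parity_add {x₀ x₁ : A} (h₀ : x₀ ∈ A.gr 0) (h₁ : x₁ ∈ A.gr 1) :
    A.parity (x₀ + x₁) = x₀ - x₁ := by
  rw [map_add, A.parity_of_mem_zero h₀, A.parity_of_mem_one h₁, sub_eq_add_neg]

theorem parity_parity (x : A) : A.parity (A.parity x) = x := by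
  obtain ⟨x₀, h₀, x₁, h₁, rfl⟩ := A.exists_add x
  rw [A.parity_add h₀ h₁, sub_eq_add_neg, A.parity_add h₀ (neg_mem h₁), sub_neg_eq_add]

theorem parity_mul (x y : A) : A.parity (x * y) = A.parity x * A.parity y := by
  obtain ⟨x₀, h₀, x₁, h₁, rfl⟩ := A.exists_add x
  obtain ⟨y₀, k₀, y₁, k₁, rfl⟩ := A.exists_add y
  have e00 := A.mul_mem 0 0 _ _ h₀ k₀
  have e11 := A.mul_mem 1 1 _ _ h₁ k₁
  have e01 := A.mul_mem 0 1 _ _ h₀ k₁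
  have e10 := A.mul_mem 1 0 _ _ h₁ k₀
  rw [show (1 + 1 : ZMod 2) = 0 from rfl] at e11
  rw [A.parity_add h₀ h₁, A.parity_add k₀ k₁]
  simp only [add_mul, mul_add, sub_mul, mul_sub, map_add, A.parity_of_mem_zero e00,
    A.parity_of_mem_zero e11, A.parity_of_mem_one e01, A.parity_of_mem_one e10]
  abel

/-- As 2 is invertible, the homogeneous components are the eigenspaces of `parity`. Gradedness of
subspaces and maps then becomes compatibility with one involution. -/
theorem mem_gr_zero_iff [NeZero (2 : K)] {x : A} : x ∈ A.gr 0 ↔ A.parity x = x := by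
  refine ⟨A.parity_of_mem_zero, fun h => ?_⟩
  obtain ⟨x₀, h₀, x₁, h₁, rfl⟩ := A.exists_add x
  rw [A.parity_add h₀ h₁] at h
  have : (2 : K) • x₁ = 0 := by
    rw [two_smul]
    have := sub_eq_zero.2 h.symm
    rwa [add_sub_sub_cancel] at this
  rw [(smul_eq_zero.1 this).resolve_left two_ne_zero, add_zero]
  exact h₀

theorem mem_gr_one_iff [NeZero (2 : K)] {x : A} : x ∈ A.gr 1 ↔ A.parity x = -x := by
  refine ⟨A.parity_of_mem_one, fun h => ?_⟩
  obtain ⟨x₀, h₀, x₁, h₁, rfl⟩ := A.exists_add x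
  rw [A.parity_add h₀ h₁] at h
  have : (2 : K) • x₀ = 0 := by
    rw [two_smul]
    have := sub_eq_zero.2 h
    rwa [sub_neg_eq_add, sub_add_add_cancel] at this
  rw [(smul_eq_zero.1 this).resolve_left two_ne_zero, zero_add]
  exact h₁

/-- A linear map which intertwines the parity automorphisms is even. -/
theorem map_mem_gr_of_parity [NeZero (2 : K)] {A : Superalgebra.{u, v} K}
    {V : Superalgebra.{u, w} K} {φ : A →ₗ[K] V} (h : ∀ x, φ (A.parity x) = V.parity (φ x))
    (i : ZMod 2) (x : A) (hx : x ∈ A.gr i) : φ x ∈ V.gr i := by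
  have hz : ∀ k : ZMod 2, k = 0 ∨ k = 1 := by decide
  rcases hz i with rfl | rfl
  · rw [mem_gr_zero_iff, ← h, A.parity_of_mem_zero hx]
  · rw [mem_gr_one_iff, ← h, A.parity_of_mem_one hx, map_neg]

theorem parity_map {A : Superalgebra.{u, v} K} {V : Superalgebra.{u, w} K} {φ : A →ₗ[K] V}
    (h : ∀ i x, x ∈ A.gr i → φ x ∈ V.gr i) (x : A) : φ (A.parity x) = V.parity (φ x) := by
  obtain ⟨x₀, h₀, x₁, h₁, rfl⟩ := A.exists_add x
  rw [A.parity_add h₀ h₁, map_add, V.parity_add (h 0 _ h₀) (h 1 _ h₁), map_sub]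

/-- Graded (two-sided) ideals. -/
structure IsGradedIdeal (I : Submodule K A) : Prop where
  parity_mem : ∀ x ∈ I, A.parity x ∈ I
  mul_left_mem : ∀ a, ∀ x ∈ I, a * x ∈ I
  mul_right_mem : ∀ a, ∀ x ∈ I, x * a ∈ I

end Superalgebra

/-! ### Existence of splittings and orthogonal decompositions. -/

namespace OddSymmetricSuperalgebra

variable (A : OddSymmetricSuperalgebra.{u, v} K)

theorem isRefl_form : A.form.IsRefl := fun x y h => (A.form_symm y x).trans h

/-- Only components of opposite degree pair nontrivially, and `parity` changes the sign of exactly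
one of them. Therefore orthogonals of graded subspaces are graded. -/
theorem form_parity (x y : A) : A.form (A.parity x) y = -A.form x (A.parity y) := by
  obtain ⟨x₀, h₀, x₁, h₁, rfl⟩ := A.exists_add x
  obtain ⟨y₀, k₀, y₁, k₁, rfl⟩ := A.exists_add y
  have e1 := A.form_odd 0 0 _ _ h₀ k₀ rfl
  have e2 := A.form_odd 1 1 _ _ h₁ k₁ rfl
  rw [A.parity_add h₀ h₁, A.parity_add k₀ k₁]
  simp only [map_add, map_sub, LinearMap.add_apply, LinearMap.sub_apply, e1, e2]
  ring

theorem isGradedIdeal_orthogonal {I : Submodule K A} (hI : A.IsGradedIdeal I) :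
    A.IsGradedIdeal (A.form.orthogonal I) where
  parity_mem x hx y hy := by
    change A.form y (A.parity x) = 0
    rw [← neg_eq_zero, ← A.form_parity]
    exact hx _ (hI.parity_mem y hy)
  mul_left_mem a x hx y hy := by
    change A.form y (a * x) = 0
    rw [← A.form_assoc]
    exact hx _ (hI.mul_right_mem a y hy)
  mul_right_mem a x hx y hy := by
    change A.form y (x * a) = 0
    rw [← A.form_assoc, A.form_cyclic]
    exact hx _ (hI.mul_left_mem a y hy)

/-- A splitting exists for every even surjective homomorphism the kernel of which contains its
orthogonal. -/
theorem exists_splitting [NeZero (2 : K)] {V : Superalgebra.{u, w} K} (π : A →ₗ[K] V)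
    (hmul : ∀ x y, π (x * y) = π x * π y) (heven : ∀ i x, x ∈ A.gr i → π x ∈ V.gr i)
    (hsurj : Function.Surjective π)
    (hker : A.form.orthogonal (LinearMap.ker π) ≤ LinearMap.ker π) : Nonempty (Splitting A V) := by
  -- The transpose of `π` read through `A ≅ A^*`; its image is orthogonal to `ker π`, hence lies in
  -- `ker π` by `hker`.
  let emb : Module.Dual K V →ₗ[K] A := (A.form.toDual A.nondegenerate).symm ∘ₗ π.dualMap
  have form_emb : ∀ f x, A.form (emb f) x = f (π x) := fun f x =>
    LinearMap.BilinForm.apply_toDual_symm_apply (hB := A.nondegenerate) (π.dualMap f) x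
  have proj_emb : ∀ f, π (emb f) = 0 := fun f => hker fun x hx => by
    change A.form x (emb f) = 0
    rw [A.form_symm, form_emb, LinearMap.mem_ker.1 hx, map_zero]
  obtain ⟨t, ht⟩ := π.exists_rightInverse_of_surjective (LinearMap.range_eq_top.2 hsurj)
  have ht' : ∀ a, π (t a) = a := fun a => congrArg (· a) ht
  -- Averaging an arbitrary linear section over the parity involutions makes it even.
  let s₀ : V →ₗ[K] A := (2⁻¹ : K) • (t + A.parity ∘ₗ t ∘ₗ V.parity)
  have s₀_apply : ∀ a, s₀ a = (2⁻¹ : K) • (t a + A.parity (t (V.parity a))) := fun a => rfl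
  have hs₀ : ∀ a, π (s₀ a) = a := fun a => by
    rw [s₀_apply, map_smul, map_add, Superalgebra.parity_map heven, ht', ht', V.parity_parity,
      ← two_smul K, smul_smul, inv_mul_cancel₀ two_ne_zero, one_smul]
  have s₀_even : ∀ i a, a ∈ V.gr i → s₀ a ∈ A.gr i :=
    Superalgebra.map_mem_gr_of_parity fun a => by
      rw [s₀_apply, s₀_apply, map_smul, map_add, V.parity_parity, A.parity_parity, add_comm]
  -- The obstruction `h` to isotropy of `s₀` is symmetric. Subtracting half of `emb ∘ h` removes it,
  -- since each of the two cross terms contributes half of `h` and the image of `emb` is isotropic.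
  let h : V →ₗ[K] Module.Dual K V := A.form.compl₁₂ s₀ s₀
  have h_apply : ∀ a b, h a b = A.form (s₀ a) (s₀ b) := fun a b => rfl
  refine ⟨⟨π, s₀ - (2⁻¹ : K) • emb ∘ₗ h, emb, hmul, heven, fun i a ha => ?_, fun a => ?_,
    fun a b => ?_, form_emb, proj_emb⟩⟩
  · refine sub_mem (s₀_even i a ha) (Submodule.smul_mem _ _ ?_)
    refine (A.mem_gr_iff_form i _).2 fun y hy => ?_
    rw [LinearMap.comp_apply, form_emb, h_apply]
    exact (A.mem_gr_iff_form i _).1 (s₀_even i a ha) _ (s₀_even i _ (heven i y hy))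
  · change π (s₀ a - (2⁻¹ : K) • emb (h a)) = a
    rw [map_sub, map_smul, proj_emb, smul_zero, sub_zero, hs₀]
  · change A.form (s₀ a - (2⁻¹ : K) • emb (h a)) (s₀ b - (2⁻¹ : K) • emb (h b)) = 0
    simp only [map_sub, map_smul, LinearMap.sub_apply, LinearMap.smul_apply]
    rw [A.form_symm (s₀ a) (emb _), form_emb, form_emb, form_emb, proj_emb, hs₀, hs₀, h_apply,
      h_apply, A.form_symm (s₀ b), map_zero, smul_zero, sub_zero, sub_sub,
      ← two_smul K (2⁻¹ • _), smul_smul, mul_inv_cancel₀ two_ne_zero, one_smul, sub_self]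

theorem Isomorphic.of_symm {A : OddSymmetricSuperalgebra.{u, v} K}
    {A' : OddSymmetricSuperalgebra.{u, w} K} (e : A' ≃ₗ[K] A) (hmul : ∀ x y, e (x * y) = e x * e y)
    (hgr : ∀ i x, x ∈ A'.gr i ↔ e x ∈ A.gr i)
    (hform : ∀ x y, A.form (e x) (e y) = A'.form x y) : A.Isomorphic A' :=
  ⟨e.symm, fun x y => e.injective <| by
      rw [hmul, e.apply_symm_apply, e.apply_symm_apply, e.apply_symm_apply],
    fun i x => by rw [hgr, e.apply_symm_apply],
    fun x y => by rw [← hform, e.apply_symm_apply, e.apply_symm_apply]⟩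

/-- The ring structure of a graded ideal. -/
@[reducible]
def idealRing {I : Submodule K A} (hI : A.IsGradedIdeal I) : NonUnitalRing I where
  mul x y := ⟨x * y, hI.mul_left_mem _ _ y.2⟩
  left_distrib x y z := Subtype.ext (mul_add x.1 y.1 z.1)
  right_distrib x y z := Subtype.ext (add_mul x.1 y.1 z.1)
  zero_mul x := Subtype.ext (zero_mul x.1)
  mul_zero x := Subtype.ext (mul_zero x.1)
  mul_assoc x y z := Subtype.ext (mul_assoc x.1 y.1 z.1)

/-- A graded ideal on which the form is non-degenerate, as an odd-symmetric superalgebra. -/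
def ofIdeal [NeZero (2 : K)] {I : Submodule K A} (hI : A.IsGradedIdeal I)
    (hd : Disjoint I (A.form.orthogonal I)) : OddSymmetricSuperalgebra.{u, v} K where
  carrier := I
  ring := A.idealRing hI
  tower := by
    let := A.idealRing hI
    exact ⟨fun k x y => Subtype.ext (smul_mul_assoc k x.1 y.1)⟩
  comm := by
    let := A.idealRing hI
    exact ⟨fun k x y => Subtype.ext (mul_smul_comm k x.1 y.1).symm⟩
  gr i := (A.gr i).comap I.subtype
  isCompl := by
    constructor
    · rw [Submodule.disjoint_def]
      exact fun x h0 h1 => Subtype.ext (Submodule.disjoint_def.1 A.isCompl.disjoint _ h0 h1)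
    · rw [codisjoint_iff, Submodule.eq_top_iff']
      rintro ⟨x, hx⟩
      have hpx := hI.parity_mem x hx
      obtain ⟨x₀, h₀, x₁, h₁, rfl⟩ := A.exists_add x
      rw [A.parity_add h₀ h₁] at hpx
      have hx₀ : x₀ ∈ I := by
        have : (2 : K) • x₀ ∈ I := by
          rw [two_smul]
          simpa using add_mem hx hpx
        exact (Submodule.smul_mem_iff _ two_ne_zero).1 this
      exact Submodule.mem_sup.2 ⟨⟨x₀, hx₀⟩, h₀, ⟨x₁, (add_mem_cancel_left hx₀).1 hx⟩, h₁, rfl⟩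
  mul_mem i j x y hx hy := A.mul_mem i j _ _ hx hy
  form := A.form.compl₁₂ I.subtype I.subtype
  form_odd i j x y hx hy h := A.form_odd i j _ _ hx hy h
  form_supersymm i j x y hx hy := A.form_supersymm i j _ _ hx hy
  form_assoc x y z := A.form_assoc _ _ _
  form_nondeg x hx := Subtype.ext <| Submodule.disjoint_def.1 hd x.1 x.2 fun y hy =>
    (A.form_symm _ _).trans (hx ⟨y, hy⟩)

theorem isomorphic_orthSum [NeZero (2 : K)] {I J : Submodule K A} (hI : A.IsGradedIdeal I)
    (hdI : Disjoint I (A.form.orthogonal I)) (hJ : A.IsGradedIdeal J)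
    (hdJ : Disjoint J (A.form.orthogonal J)) (hIJ : IsCompl I J)
    (horth : ∀ x ∈ I, ∀ y ∈ J, A.form x y = 0) :
    A.Isomorphic ((A.ofIdeal hI hdI).orthSum (A.ofIdeal hJ hdJ)) := by
  -- Products of elements of two complementary ideals lie in the intersection, so they vanish.
  have hxy : ∀ x ∈ I, ∀ y ∈ J, x * y = 0 := fun x hx y hy =>
    Submodule.disjoint_def.1 hIJ.disjoint _ (hI.mul_right_mem y x hx) (hJ.mul_left_mem x y hy)
  have hyx : ∀ x ∈ I, ∀ y ∈ J, y * x = 0 := fun x hx y hy =>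
    Submodule.disjoint_def.1 hIJ.disjoint _ (hI.mul_left_mem y x hx) (hJ.mul_right_mem x y hy)
  let e : (I × J) ≃ₗ[K] A := Submodule.prodEquivOfIsCompl I J hIJ
  have he : ∀ p, e p = p.1 + p.2 := fun p => rfl
  have hpar : ∀ p : I × J, A.parity (e p) =
      e (⟨A.parity p.1, hI.parity_mem _ p.1.2⟩, ⟨A.parity p.2, hJ.parity_mem _ p.2.2⟩) :=
    fun p => map_add _ _ _
  refine Isomorphic.of_symm e (fun (p q : I × J) => ?_) (fun i (p : I × J) => ?_)
    (fun (p q : I × J) => ?_)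
  · change (p.1.1 * q.1.1 + p.2.1 * q.2.1 : A) = (p.1.1 + p.2.1) * (q.1.1 + q.2.1)
    rw [add_mul, mul_add, mul_add, hxy _ p.1.2 _ q.2.2, hyx _ q.1.2 _ p.2.2, add_zero, zero_add]
  · refine ⟨fun h => add_mem h.1 h.2, fun h => ?_⟩
    change p.1.1 ∈ A.gr i ∧ p.2.1 ∈ A.gr i
    have hz : ∀ k : ZMod 2, k = 0 ∨ k = 1 := by decide
    rcases hz i with rfl | rfl
    · rw [A.mem_gr_zero_iff] at h ⊢
      have h' := e.injective ((hpar p).symm.trans h)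
      rw [A.mem_gr_zero_iff]
      exact ⟨congrArg (fun z : I × J => z.1.1) h', congrArg (fun z : I × J => z.2.1) h'⟩
    · rw [A.mem_gr_one_iff] at h ⊢
      have h' := e.injective ((hpar p).symm.trans (h.trans (map_neg e p).symm))
      rw [A.mem_gr_one_iff]
      exact ⟨congrArg (fun z : I × J => z.1.1) h', congrArg (fun z : I × J => z.2.1) h'⟩
  · change A.form (p.1.1 + p.2.1) (q.1.1 + q.2.1) = A.form p.1.1 q.1.1 + A.form p.2.1 q.2.1
    simp only [map_add, LinearMap.add_apply, horth _ p.1.2 _ q.2.2, A.form_symm p.2.1 q.1.1,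
      horth _ q.1.2 _ p.2.2, add_zero, zero_add]

end OddSymmetricSuperalgebra

/-! ### Graded irreducible algebras of endomorphisms. -/

section EndomorphismAlgebras

variable {L : Type w} [AddCommGroup L] [Module K L] [FiniteDimensional K L]

/-- Burnside's theorem: an irreducible algebra of endomorphisms over an algebraically closed field
contains all endomorphisms. -/
theorem eq_top_of_irreducible [IsAlgClosed K] [Nontrivial L] (R : Subalgebra K (Module.End K L))
    (h : ∀ U : Submodule K L, (∀ r ∈ R, ∀ x ∈ U, r x ∈ U) → U = ⊥ ∨ U = ⊤) : R = ⊤ := by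
  classical
  have hsimple : IsSimpleModule R L := by
    refine { toIsSimpleOrder := { exists_pair_ne := ⟨⊥, ⊤, bot_ne_top⟩, eq_bot_or_eq_top := ?_ } }
    intro U
    rcases h (U.restrictScalars K) fun r hr x hx => U.smul_mem ⟨r, hr⟩ hx with h | h
    · exact Or.inl ((Submodule.restrictScalars_eq_bot_iff _ _ _).1 h)
    · exact Or.inr ((Submodule.restrictScalars_eq_top_iff _ _ _).1 h)
  refine Algebra.eq_top_iff.2 fun f => ?_
  -- By Schur's lemma the commutant is `K`, so every `K`-linear `f` commutes with it; density then
  -- yields an element of `R` that agrees with `f` on a basis.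
  have hS := (IsSimpleModule.algebraMap_end_bijective_of_isAlgClosed (A := R) (V := L) K).2
  let F : Module.End (Module.End R L) L :=
    { toFun := f
      map_add' := map_add f
      map_smul' := fun φ x => by
        obtain ⟨k, rfl⟩ := hS φ
        exact map_smul f k x }
  let b := Module.finBasis K L
  obtain ⟨r, hr⟩ := jacobson_density (R := R) F (Finset.univ.image b)
  have : f = r := b.ext fun i => hr (b i) (Finset.mem_image_of_mem _ (Finset.mem_univ i))
  rw [this]
  exact r.2

/-- The algebra of all endomorphisms of a vector space is simple. -/
theorem eq_bot_or_eq_top_of_ideal (T : Submodule K (Module.End K L))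
    (hl : ∀ r, ∀ t ∈ T, r * t ∈ T) (hr : ∀ r, ∀ t ∈ T, t * r ∈ T) : T = ⊥ ∨ T = ⊤ := by
  refine or_iff_not_imp_left.2 fun hT => ?_
  obtain ⟨t, ht, ht0⟩ := Submodule.exists_mem_ne_zero_of_ne_bot hT
  obtain ⟨x, hx⟩ : ∃ x, t x ≠ 0 := by
    by_contra! h
    exact ht0 (LinearMap.ext h)
  obtain ⟨ψ, hψ⟩ := Module.Projective.exists_dual_eq_one K hx
  -- Since `ψ (t x) = 1`, multiplying `t` by rank-one maps on both sides yields every rank-one map,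
  -- and the identity is a sum of these.
  have key : ∀ (φ : Module.Dual K L) (v : L), φ.smulRight v ∈ T := fun φ v => by
    have : φ.smulRight v = ψ.smulRight v * t * φ.smulRight x := by
      refine LinearMap.ext fun y => ?_
      change φ y • v = ψ (t (φ y • x)) • v
      rw [map_smul, map_smul, hψ, smul_eq_mul, mul_one]
    rw [this]
    exact hr _ _ (hl _ _ ht)
  let b := Module.finBasis K L
  have h1 : (1 : Module.End K L) = ∑ i, (b.coord i).smulRight (b i) :=
    LinearMap.ext fun y => by
      rw [LinearMap.sum_apply]
      exact (b.sum_repr y).symm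
  rw [Submodule.eq_top_iff']
  intro r
  rw [← mul_one r, h1]
  exact hl _ _ (Submodule.sum_mem _ fun i _ => key _ _)

/-- A nonzero algebra `S` of endomorphisms which is stable under conjugation by an involution `g`
and irreducible together with `g`: every endomorphism is of the form `s + t * g` with `s`, `t` in
`S`. -/
theorem exists_add_mul_of_irreducible [IsAlgClosed K] (g : Module.End K L) (hg : g * g = 1)
    (S : Submodule K (Module.End K L)) (hS : ∀ a ∈ S, ∀ b ∈ S, a * b ∈ S)
    (hgS : ∀ a ∈ S, g * a * g ∈ S) (hne : S ≠ ⊥)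
    (hirr : ∀ U : Submodule K L, (∀ x ∈ U, g x ∈ U) → (∀ a ∈ S, ∀ x ∈ U, a x ∈ U) →
      U = ⊥ ∨ U = ⊤) (r : Module.End K L) : ∃ s ∈ S, ∃ t ∈ S, s + t * g = r := by
  obtain ⟨s₀, hs₀, hs₀0⟩ := Submodule.exists_mem_ne_zero_of_ne_bot hne
  have : Nontrivial L := by
    by_contra h
    rw [not_nontrivial_iff_subsingleton] at h
    exact hs₀0 (Subsingleton.elim _ _)
  have hR : Algebra.adjoin K (insert g (S : Set (Module.End K L))) = ⊤ :=
    eq_top_of_irreducible _ fun U hU => hirr U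
      (hU g (Algebra.subset_adjoin (Set.mem_insert _ _)))
      fun a ha => hU a (Algebra.subset_adjoin (Set.mem_insert_of_mem _ ha))
  -- `N = S + S g` is stable under multiplication by `S` and `g`, which generate `End L` by
  -- Burnside. It is therefore a nonzero ideal of a simple algebra. `S` need not contain `1`.
  let N : Submodule K (Module.End K L) := S ⊔ S.map (LinearMap.mulRight K g)
  have memN : ∀ n, n ∈ N ↔ ∃ s ∈ S, ∃ t ∈ S, s + t * g = n := fun n => by
    rw [Submodule.mem_sup]
    refine ⟨?_, ?_⟩
    · rintro ⟨s, hs, _, ⟨t, ht, rfl⟩, rfl⟩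
      exact ⟨s, hs, t, ht, rfl⟩
    · rintro ⟨s, hs, t, ht, rfl⟩
      exact ⟨s, hs, _, ⟨t, ht, rfl⟩, rfl⟩
  have hggl : ∀ x, g * (g * x) = x := fun x => by rw [← mul_assoc, hg, one_mul]
  have hggr : ∀ x, x * g * g = x := fun x => by rw [mul_assoc, hg, mul_one]
  have hN : ∀ r : Module.End K L, ∀ n ∈ N, r * n ∈ N ∧ n * r ∈ N := by
    intro r
    have hr : r ∈ Algebra.adjoin K (insert g (S : Set (Module.End K L))) := hR ▸ Algebra.mem_top
    induction hr using Algebra.adjoin_induction with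
    | mem a ha =>
      intro n hn
      obtain ⟨s, hs, t, ht, rfl⟩ := (memN n).1 hn
      rcases ha with rfl | ha
      · refine ⟨(memN _).2 ⟨_, hgS t ht, _, hgS s hs, ?_⟩, (memN _).2 ⟨t, ht, s, hs, ?_⟩⟩
        · rw [hggr, mul_add, ← mul_assoc, add_comm]
        · rw [add_mul, hggr, add_comm]
      · refine ⟨(memN _).2 ⟨_, hS a ha s hs, _, hS a ha t ht, ?_⟩,
          (memN _).2 ⟨_, hS s hs a ha, _, hS t ht _ (hgS a ha), ?_⟩⟩
        · rw [mul_add, ← mul_assoc]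
        · rw [add_mul, mul_assoc t, hggr, mul_assoc t g a]
    | algebraMap k =>
      intro n hn
      rw [← Algebra.commutes, ← Algebra.smul_def]
      exact ⟨N.smul_mem k hn, N.smul_mem k hn⟩
    | add a b _ _ ha hb =>
      intro n hn
      rw [add_mul, mul_add]
      exact ⟨add_mem (ha n hn).1 (hb n hn).1, add_mem (ha n hn).2 (hb n hn).2⟩
    | mul a b _ _ ha hb =>
      intro n hn
      rw [mul_assoc, ← mul_assoc n]
      exact ⟨(ha _ (hb n hn).1).1, (hb _ (ha n hn).2).2⟩
  rcases eq_bot_or_eq_top_of_ideal N (fun r n hn => (hN r n hn).1) (fun r n hn => (hN r n hn).2)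
    with h | h
  · exact absurd (le_bot_iff.1 (h ▸ le_sup_left)) hne
  · exact (memN r).1 (h ▸ Submodule.mem_top)

/-- The algebra of endomorphisms as a superalgebra with even part `S` and odd part `S * g`. -/
def endSuper (g : Module.End K L) (hg : g * g = 1)
    (S : Submodule K (Module.End K L)) (hS : ∀ a ∈ S, ∀ b ∈ S, a * b ∈ S)
    (hgS : ∀ a ∈ S, g * a * g ∈ S) (hadd : ∀ r, ∃ s ∈ S, ∃ t ∈ S, s + t * g = r)
    (hinf : ∀ t ∈ S, t * g ∈ S → t = 0) : Superalgebra.{u, w} K where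
  carrier := Module.End K L
  gr i := if i = 0 then S else S.map (LinearMap.mulRight K g)
  isCompl := by
    rw [if_pos rfl, if_neg one_ne_zero]
    constructor
    · rw [Submodule.disjoint_def]
      rintro _ h0 ⟨t, ht, rfl⟩
      rw [hinf t ht h0, map_zero]
    · rw [codisjoint_iff, Submodule.eq_top_iff']
      intro r
      obtain ⟨s, hs, t, ht, rfl⟩ := hadd r
      exact Submodule.mem_sup.2 ⟨s, hs, _, ⟨t, ht, rfl⟩, rfl⟩
  mul_mem i j x y hx hy := by
    have hz : ∀ k : ZMod 2, k = 0 ∨ k = 1 := by decide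
    have h11 : (1 + 1 : ZMod 2) = 0 := rfl
    rcases hz i with rfl | rfl <;> rcases hz j with rfl | rfl <;>
      simp only [add_zero, zero_add, h11, if_true, one_ne_zero, if_false] at hx hy ⊢
    · exact hS x hx y hy
    · obtain ⟨t, ht, rfl⟩ := hy
      exact ⟨_, hS x hx t ht, mul_assoc _ _ _⟩
    · obtain ⟨t, ht, rfl⟩ := hx
      refine ⟨_, hS t ht _ (hgS y hy), ?_⟩
      change t * (g * y * g) * g = t * g * y
      rw [mul_assoc t, mul_assoc (g * y), hg, mul_one, mul_assoc]
    · obtain ⟨s, hs, rfl⟩ := hx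
      obtain ⟨t, ht, rfl⟩ := hy
      change s * g * (t * g) ∈ S
      rw [mul_assoc, ← mul_assoc g]
      exact hS _ hs _ (hgS t ht)

/-- An algebra `S ≠ 0` of endomorphisms which is stable under conjugation by an involution `g` and
irreducible together with `g` contains all endomorphisms or is the centralizer of an involution
which anticommutes with `g`. -/
theorem eq_top_or_exists_centralizer [IsAlgClosed K] [NeZero (2 : K)] (g : Module.End K L)
    (hg : g * g = 1) (S : Submodule K (Module.End K L)) (hS : ∀ a ∈ S, ∀ b ∈ S, a * b ∈ S)
    (hgS : ∀ a ∈ S, g * a * g ∈ S) (hne : S ≠ ⊥)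
    (hirr : ∀ U : Submodule K L, (∀ x ∈ U, g x ∈ U) → (∀ a ∈ S, ∀ x ∈ U, a x ∈ U) →
      U = ⊥ ∨ U = ⊤) :
    S = ⊤ ∨ ∃ θ : Module.End K L, θ * θ = 1 ∧ θ * g = -(g * θ) ∧
      ∀ r, r ∈ S ↔ θ * r = r * θ := by
  have hadd := exists_add_mul_of_irreducible g hg S hS hgS hne hirr
  have hggr : ∀ x, x * g * g = x := fun x => by rw [mul_assoc, hg, mul_one]
  -- `T = S ∩ S g` is an ideal of `End L`. If it is everything, so is `S`; if it is zero, `End L = S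
  -- ⊕ S g` is a grading.
  let T : Submodule K (Module.End K L) := S ⊓ S.comap (LinearMap.mulRight K g)
  have memT : ∀ t, t ∈ T ↔ t ∈ S ∧ t * g ∈ S := fun t => Iff.rfl
  have hTg : ∀ t ∈ T, t * g ∈ T := fun t ht => (memT _).2 ⟨ht.2, by rw [hggr]; exact ht.1⟩
  have hgT : ∀ t ∈ T, g * t ∈ T := fun t ht => by
    have h1 := hgS _ ht.2
    change g * (t * g) * g ∈ S at h1
    rw [← mul_assoc, hggr] at h1
    exact (memT _).2 ⟨h1, hgS _ ht.1⟩
  have hST : ∀ s ∈ S, ∀ t ∈ T, s * t ∈ T := fun s hs t ht =>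
    (memT _).2 ⟨hS s hs t ht.1, by rw [mul_assoc]; exact hS s hs _ ht.2⟩
  have hTS : ∀ s ∈ S, ∀ t ∈ T, t * s ∈ T := fun s hs t ht => by
    refine (memT _).2 ⟨hS t ht.1 s hs, ?_⟩
    have h1 := hS _ ht.2 _ (hgS s hs)
    change t * g * (g * s * g) ∈ S at h1
    rwa [mul_assoc g, ← mul_assoc, hggr, ← mul_assoc] at h1
  rcases eq_bot_or_eq_top_of_ideal T
    (fun r t ht => by
      obtain ⟨a, ha, b, hb, rfl⟩ := hadd r
      rw [add_mul, mul_assoc]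
      exact add_mem (hST a ha t ht) (hST b hb _ (hgT t ht)))
    (fun r t ht => by
      obtain ⟨a, ha, b, hb, rfl⟩ := hadd r
      rw [mul_add, ← mul_assoc]
      exact add_mem (hTS a ha t ht) (hTg _ (hTS b hb t ht))) with hT | hT
  swap
  · exact Or.inl (top_le_iff.1 (hT ▸ inf_le_left))
  right
  have hinf : ∀ t ∈ S, t * g ∈ S → t = 0 := fun t h1 h2 => by
    have : t ∈ T := ⟨h1, h2⟩
    rwa [hT, Submodule.mem_bot] at this
  -- Write `1 = a + b g`. For `s` in `S`, both `s b` and `s b g = s - s a` lie in `S`, so `s b = 0`.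
  -- Hence `b = (a + b g) b = g (g b g) b = 0`.
  have h1S : (1 : Module.End K L) ∈ S := by
    obtain ⟨a, ha, b, hb, h1⟩ := hadd 1
    have hSb : ∀ s ∈ S, s * b = 0 := fun s hs => by
      refine hinf _ (hS s hs b hb) ?_
      have : s * b * g = s - s * a := by
        rw [mul_assoc, eq_sub_of_add_eq' h1, mul_sub, mul_one]
      rw [this]
      exact sub_mem hs (hS s hs a ha)
    have hb0 : b = 0 := by
      have h2 : (a + b * g) * b = 0 := by
        rw [add_mul, hSb a ha, zero_add, mul_assoc]
        have h3 := hSb _ (hgS b hb)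
        have h4 : b * (g * b) = g * (g * b * g * b) := by
          simp only [← mul_assoc, hg, one_mul]
        rw [h4, h3, mul_zero]
      rwa [h1, one_mul] at h2
    rw [hb0, zero_mul, add_zero] at h1
    exact h1 ▸ ha
  let E := endSuper g hg S hS hgS hadd hinf
  have mem0 : ∀ r : Module.End K L, r ∈ E.gr 0 ↔ r ∈ S := fun r => Iff.rfl
  -- The parity of this grading is an automorphism of `End L`, hence conjugation by some `θ`. Its
  -- fixed algebra `S` is the centralizer of `θ`, and `θ` anticommutes with the odd element `g`.
  let τ : Module.End K L ≃ₐ[K] Module.End K L :=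
    AlgEquiv.ofLinearEquiv (LinearEquiv.ofInvolutive (R := K) (M := E) E.parity E.parity_parity)
      (E.parity_of_mem_zero ((mem0 1).2 h1S)) E.parity_mul
  obtain ⟨t, ht⟩ := AlgEquiv.eq_linearEquivConjAlgEquiv τ
  have hτ : ∀ r, τ r * t.toLinearMap = t.toLinearMap * r := fun r => by
    rw [ht]
    refine LinearMap.ext fun x => ?_
    change t (r (t.symm (t x))) = t (r x)
    rw [t.symm_apply_apply]
  have τS : ∀ r, r ∈ S ↔ τ r = r := fun r => E.mem_gr_zero_iff
  set θ : Module.End K L := t.toLinearMap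
  have hθg : θ * g = -(g * θ) := by
    rw [← hτ, ← neg_mul]
    exact congrArg (· * θ) (E.parity_of_mem_one (x := g) ⟨1, h1S, one_mul g⟩)
  have hinj : ∀ a b : Module.End K L, a * θ = b * θ → a = b := fun a b h =>
    LinearMap.ext fun x => by
      have := congrArg (fun f : Module.End K L => f (t.symm x)) h
      change a (t (t.symm x)) = b (t (t.symm x)) at this
      rwa [t.apply_symm_apply] at this
  have hcomm : ∀ r, r ∈ S ↔ θ * r = r * θ := fun r => by
    rw [← hτ, τS]
    exact ⟨fun h => by rw [h], hinj _ _⟩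
  -- `θ²` commutes with `S` and with `g`, so it is a scalar; dividing `θ` by a square root of this
  -- scalar makes it an involution.
  have hθθ : θ * θ ∈ Subalgebra.center K (Module.End K L) := by
    rw [Subalgebra.mem_center_iff]
    intro r
    obtain ⟨a, ha, b, hb, rfl⟩ := hadd r
    have e1 : ∀ s ∈ S, s * (θ * θ) = θ * θ * s := fun s hs => by
      rw [← mul_assoc, ← (hcomm s).1 hs, mul_assoc, ← (hcomm s).1 hs, mul_assoc]
    have e2 : g * (θ * θ) = θ * θ * g := by
      rw [mul_assoc, hθg, mul_neg, ← mul_assoc, ← mul_assoc, hθg, neg_mul, neg_neg]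
    rw [add_mul, mul_add, e1 a ha, mul_assoc b, e2, ← mul_assoc b, e1 b hb, mul_assoc (θ * θ) b]
  rw [Algebra.IsCentral.center_eq_bot] at hθθ
  obtain ⟨c, hc⟩ := Algebra.mem_bot.1 hθθ
  obtain ⟨z, hz⟩ := IsAlgClosed.exists_pow_nat_eq c two_pos
  by_cases hz0 : z = 0
  · exfalso
    rw [hz0, zero_pow two_ne_zero] at hz
    rw [← hz, map_zero] at hc
    have h1 : (1 : Module.End K L) = 0 := hinj _ _ (hinj _ _ (by
      rw [one_mul, ← hc, zero_mul, zero_mul]))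
    refine hne (eq_bot_iff.2 fun s _ => ?_)
    rw [Submodule.mem_bot, ← one_mul s, h1, zero_mul]
  · refine ⟨z⁻¹ • θ, ?_, ?_, fun r => ?_⟩
    · rw [smul_mul_smul_comm, ← hc, ← hz, Algebra.algebraMap_eq_smul_one, smul_smul, ← sq,
        inv_pow, inv_mul_cancel₀ (pow_ne_zero 2 hz0), one_smul]
    · rw [smul_mul_assoc, mul_smul_comm, hθg, smul_neg]
    · rw [hcomm, smul_mul_assoc, mul_smul_comm]
      exact ⟨fun h => by rw [h], fun h => smul_right_injective _ (inv_ne_zero hz0) h⟩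

end EndomorphismAlgebras

/-! ### Matrix models and adapted bases. -/

section Matrices

open Matrix

/-- The matrix `diag(1, -1)`, conjugation by which is the parity automorphism of `M_{r,s}(K)`. -/
def parityMatrix (K : Type u) [Field K] (r s : ℕ) : Matrix (Fin r ⊕ Fin s) (Fin r ⊕ Fin s) K :=
  fromBlocks 1 0 0 (-1)

theorem parity_matSuper (r s : ℕ) (M : Matrix (Fin r ⊕ Fin s) (Fin r ⊕ Fin s) K) :
    (matSuper K r s).parity M = parityMatrix K r s * M * parityMatrix K r s := by
  have h₀ : fromBlocks M.toBlocks₁₁ 0 0 M.toBlocks₂₂ ∈ matGr K r s 0 := by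
    simp [mem_matGr_zero]
  have h₁ : fromBlocks 0 M.toBlocks₁₂ M.toBlocks₂₁ 0 ∈ matGr K r s 1 := by
    simp [mem_matGr_one]
  have hM : M = fromBlocks M.toBlocks₁₁ 0 0 M.toBlocks₂₂ +
      fromBlocks 0 M.toBlocks₁₂ M.toBlocks₂₁ 0 := by
    simp [fromBlocks_add, fromBlocks_toBlocks]
  refine (congrArg (matSuper K r s).parity hM).trans
    (((matSuper K r s).parity_add h₀ h₁).trans ?_)
  change (fromBlocks M.toBlocks₁₁ 0 0 M.toBlocks₂₂ - fromBlocks 0 M.toBlocks₁₂ M.toBlocks₂₁ 0 :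
    Matrix (Fin r ⊕ Fin s) (Fin r ⊕ Fin s) K) = _
  conv_rhs => rw [hM, parityMatrix]
  simp [fromBlocks_multiply, sub_eq_add_neg, fromBlocks_neg, fromBlocks_add]

/-- The inclusion of `Q_n(K)` in `M_{n,n}(K)`. -/
def queerVal (K : Type u) [Field K] (n : ℕ) : queerSuper K n →ₗ[K] matSuper K n n :=
  (queerSubalgebra K n).toSubmodule.subtype

theorem queerVal_injective (n : ℕ) : Function.Injective (queerVal K n) := Subtype.val_injective

theorem queerVal_parity (n : ℕ) (x : queerSuper K n) :
    queerVal K n ((queerSuper K n).parity x) = (matSuper K n n).parity (queerVal K n x) :=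
  Superalgebra.parity_map (fun _ _ hy => hy) x

/-- This turns the centralizer description of `eq_top_or_exists_centralizer` into the block form of
`Q_n`, with the swap of the two blocks as the involution. -/
theorem mem_queerSubalgebra_iff {n : ℕ} {M : Matrix (Fin n ⊕ Fin n) (Fin n ⊕ Fin n) K} :
    M ∈ queerSubalgebra K n ↔ fromBlocks 0 1 1 0 * M = M * fromBlocks 0 1 1 0 := by
  have h : M = fromBlocks M.toBlocks₁₁ M.toBlocks₁₂ M.toBlocks₂₁ M.toBlocks₂₂ :=
    (fromBlocks_toBlocks M).symm
  refine ⟨?_, fun hM => ⟨M.toBlocks₁₁, M.toBlocks₁₂, ?_⟩⟩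
  · rintro ⟨a, b, rfl⟩
    simp [fromBlocks_multiply]
  · rw [h] at hM
    simp only [fromBlocks_multiply, zero_mul, mul_zero, one_mul, mul_one, zero_add, add_zero,
      fromBlocks_inj] at hM
    conv_lhs => rw [h, hM.1, hM.2.1]

end Matrices

section Bases

variable {L : Type w} [AddCommGroup L] [Module K L]

theorem exists_basis_of_isCompl {ι κ : Type*} {p q : Submodule K L} (h : IsCompl p q)
    (b₀ : Module.Basis ι K p) (b₁ : Module.Basis κ K q) :
    ∃ b : Module.Basis (ι ⊕ κ) K L, (∀ i, b (Sum.inl i) = b₀ i) ∧ ∀ j, b (Sum.inr j) = b₁ j := by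
  refine ⟨(b₀.prod b₁).map (Submodule.prodEquivOfIsCompl p q h), fun i => ?_, fun j => ?_⟩
  · simp [Module.Basis.prod_apply]
  · simp [Module.Basis.prod_apply]

theorem isCompl_ker_of_involution [NeZero (2 : K)] {g : Module.End K L} (hg : g * g = 1) :
    IsCompl (LinearMap.ker (g - 1)) (LinearMap.ker (g + 1)) := by
  have hgg : ∀ x, g (g x) = x := fun x => congrArg (· x) hg
  have m0 : ∀ x, x ∈ LinearMap.ker (g - 1) ↔ g x = x := fun x => by
    rw [LinearMap.mem_ker, LinearMap.sub_apply, Module.End.one_apply, sub_eq_zero]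
  have m1 : ∀ x, x ∈ LinearMap.ker (g + 1) ↔ g x = -x := fun x => by
    rw [LinearMap.mem_ker, LinearMap.add_apply, Module.End.one_apply, add_eq_zero_iff_eq_neg]
  constructor
  · rw [Submodule.disjoint_def]
    intro x h0 h1
    have h2 : (2 : K) • x = 0 := by
      rw [two_smul, add_eq_zero_iff_eq_neg, ← (m1 x).1 h1, (m0 x).1 h0]
    exact (smul_eq_zero.1 h2).resolve_left two_ne_zero
  · rw [codisjoint_iff, Submodule.eq_top_iff']
    intro x
    refine Submodule.mem_sup.2 ⟨(2⁻¹ : K) • (x + g x), (m0 _).2 ?_, (2⁻¹ : K) • (x - g x),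
      (m1 _).2 ?_, ?_⟩
    · rw [map_smul, map_add, hgg, add_comm]
    · rw [map_smul, map_sub, hgg, ← smul_neg, neg_sub]
    · rw [← smul_add, add_add_sub_cancel, ← two_smul K x, smul_smul, inv_mul_cancel₀ two_ne_zero,
        one_smul]

variable [FiniteDimensional K L]

theorem exists_basis_of_involution [NeZero (2 : K)] {g : Module.End K L} (hg : g * g = 1) :
    ∃ (r s : ℕ) (b : Module.Basis (Fin r ⊕ Fin s) K L),
      (∀ i, g (b (Sum.inl i)) = b (Sum.inl i)) ∧ ∀ j, g (b (Sum.inr j)) = -b (Sum.inr j) := by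
  let b₀ := Module.finBasis K (LinearMap.ker (g - 1))
  let b₁ := Module.finBasis K (LinearMap.ker (g + 1))
  obtain ⟨b, h₀, h₁⟩ := exists_basis_of_isCompl (isCompl_ker_of_involution hg) b₀ b₁
  refine ⟨_, _, b, fun i => ?_, fun j => ?_⟩
  · rw [h₀, ← sub_eq_zero]
    exact (b₀ i).2
  · rw [h₁, ← add_eq_zero_iff_eq_neg]
    exact (b₁ j).2

/-- `θ` exchanges the two eigenspaces of `g`, so a basis of the first one together with its image
under `θ` is a basis of the whole space; this forces blocks of equal size. -/
theorem exists_basis_of_anticommuting [NeZero (2 : K)] {g θ : Module.End K L} (hg : g * g = 1)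
    (hθ : θ * θ = 1) (hθg : θ * g = -(g * θ)) :
    ∃ (n : ℕ) (b : Module.Basis (Fin n ⊕ Fin n) K L),
      (∀ i, g (b (Sum.inl i)) = b (Sum.inl i)) ∧ (∀ j, g (b (Sum.inr j)) = -b (Sum.inr j)) ∧
      (∀ i, θ (b (Sum.inl i)) = b (Sum.inr i)) ∧ ∀ j, θ (b (Sum.inr j)) = b (Sum.inl j) := by
  have hθθ : ∀ x, θ (θ x) = x := fun x => congrArg (· x) hθ
  have hgθ : ∀ x, g (θ x) = -θ (g x) := fun x => by
    have := congrArg (fun f : Module.End K L => f x) hθg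
    change θ (g x) = -g (θ x) at this
    rw [this, neg_neg]
  let e : L ≃ₗ[K] L := LinearEquiv.ofInvolutive θ hθθ
  have hmap : (LinearMap.ker (g - 1)).map (e : L →ₗ[K] L) = LinearMap.ker (g + 1) := by
    ext x
    constructor
    · rintro ⟨y, hy, rfl⟩
      have hy' : g y = y := sub_eq_zero.1 hy
      change g (θ y) + θ y = 0
      rw [hgθ, hy', neg_add_cancel]
    · intro hx
      have hx' : g x = -x := add_eq_zero_iff_eq_neg.1 hx
      refine ⟨θ x, ?_, hθθ x⟩
      change g (θ x) - θ x = 0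
      rw [hgθ, hx', map_neg, neg_neg, sub_self]
  let b₀ := Module.finBasis K (LinearMap.ker (g - 1))
  let b₁ := b₀.map (e.ofSubmodules _ _ hmap)
  obtain ⟨b, h₀, h₁⟩ := exists_basis_of_isCompl (isCompl_ker_of_involution hg) b₀ b₁
  have h₁' : ∀ j, b (Sum.inr j) = θ (b (Sum.inl j)) := fun j => by
    rw [h₁, h₀]
    rfl
  refine ⟨_, b, fun i => ?_, fun j => ?_, fun i => (h₁' i).symm, fun j => ?_⟩
  · rw [h₀, ← sub_eq_zero]
    exact (b₀ i).2
  · rw [h₁, ← add_eq_zero_iff_eq_neg]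
    exact (b₁ j).2
  · rw [h₁', hθθ]

end Bases

/-! ### Simple quotients from graded representations. -/

/-- Even surjective homomorphisms of superalgebras. -/
structure IsQuotientMap {A : Superalgebra.{u, v} K} {V : Superalgebra.{u, w} K}
    (π : A →ₗ[K] V) : Prop where
  map_mul : ∀ x y, π (x * y) = π x * π y
  map_gr : ∀ i x, x ∈ A.gr i → π x ∈ V.gr i
  surjective : Function.Surjective π

section Representations

open Matrix

variable {L : Type w} [AddCommGroup L] [Module K L]

theorem toMatrixAlgEquiv_parity {r s : ℕ} {g : Module.End K L}
    (b : Module.Basis (Fin r ⊕ Fin s) K L) (h₀ : ∀ i, g (b (Sum.inl i)) = b (Sum.inl i))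
    (h₁ : ∀ j, g (b (Sum.inr j)) = -b (Sum.inr j)) :
    LinearMap.toMatrixAlgEquiv b g = parityMatrix K r s := by
  ext i j
  rw [LinearMap.toMatrixAlgEquiv_apply]
  rcases i with i | i <;> rcases j with j | j <;>
    simp [h₀, h₁, parityMatrix, Finsupp.single_apply, Matrix.one_apply, eq_comm]

theorem toMatrixAlgEquiv_swap {n : ℕ} {θ : Module.End K L}
    (b : Module.Basis (Fin n ⊕ Fin n) K L) (h₀ : ∀ i, θ (b (Sum.inl i)) = b (Sum.inr i))
    (h₁ : ∀ j, θ (b (Sum.inr j)) = b (Sum.inl j)) :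
    LinearMap.toMatrixAlgEquiv b θ = fromBlocks 0 1 1 0 := by
  ext i j
  rw [LinearMap.toMatrixAlgEquiv_apply]
  rcases i with i | i <;> rcases j with j | j <;>
    simp [h₀, h₁, Finsupp.single_apply, Matrix.one_apply, eq_comm]

variable {A : Superalgebra.{u, v} K}

/-- In the basis `b`, `g` becomes `parityMatrix`, and conjugation by it is the parity of `M_{r,s}`.
Thus `hpar` is what makes the matrix representation even. -/
theorem exists_map_matSuper [NeZero (2 : K)] {r s : ℕ} {g : Module.End K L}
    (b : Module.Basis (Fin r ⊕ Fin s) K L) (h₀ : ∀ i, g (b (Sum.inl i)) = b (Sum.inl i))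
    (h₁ : ∀ j, g (b (Sum.inr j)) = -b (Sum.inr j)) (ρ : A →ₗ[K] Module.End K L)
    (hmul : ∀ x y, ρ (x * y) = ρ x * ρ y) (hpar : ∀ x, ρ (A.parity x) = g * ρ x * g)
    (hsurj : Function.Surjective ρ) :
    ∃ π : A →ₗ[K] matSuper K r s, IsQuotientMap π ∧ LinearMap.ker π = LinearMap.ker ρ := by
  let Φ := LinearMap.toMatrixAlgEquiv b
  let π : A →ₗ[K] matSuper K r s := Φ.toLinearMap ∘ₗ ρ
  have hπ : ∀ x, π x = Φ (ρ x) := fun x => rfl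
  refine ⟨π, ⟨fun x y => ?_, Superalgebra.map_mem_gr_of_parity fun x => ?_,
    Φ.surjective.comp hsurj⟩, ?_⟩
  · rw [hπ, hmul, map_mul]; rfl
  · refine Eq.trans ?_ (parity_matSuper r s (Φ (ρ x))).symm
    rw [hπ, hpar, map_mul, map_mul, toMatrixAlgEquiv_parity b h₀ h₁]
  · ext x
    exact map_eq_zero_iff Φ Φ.injective

theorem exists_map_queerSuper [NeZero (2 : K)] {n : ℕ} {g θ : Module.End K L}
    (b : Module.Basis (Fin n ⊕ Fin n) K L) (h₀ : ∀ i, g (b (Sum.inl i)) = b (Sum.inl i))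
    (h₁ : ∀ j, g (b (Sum.inr j)) = -b (Sum.inr j)) (hθ₀ : ∀ i, θ (b (Sum.inl i)) = b (Sum.inr i))
    (hθ₁ : ∀ j, θ (b (Sum.inr j)) = b (Sum.inl j)) (ρ : A →ₗ[K] Module.End K L)
    (hmul : ∀ x y, ρ (x * y) = ρ x * ρ y) (hpar : ∀ x, ρ (A.parity x) = g * ρ x * g)
    (hrange : ∀ r, r ∈ LinearMap.range ρ ↔ θ * r = r * θ) :
    ∃ π : A →ₗ[K] queerSuper K n, IsQuotientMap π ∧ LinearMap.ker π = LinearMap.ker ρ := by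
  let Φ := LinearMap.toMatrixAlgEquiv b
  have hΦ : ∀ r, r ∈ LinearMap.range ρ ↔ Φ r ∈ queerSubalgebra K n := fun r => by
    rw [hrange, mem_queerSubalgebra_iff, ← toMatrixAlgEquiv_swap b hθ₀ hθ₁, ← map_mul, ← map_mul,
      Φ.injective.eq_iff]
  let π : A →ₗ[K] queerSuper K n :=
    (Φ.toLinearMap ∘ₗ ρ).codRestrict (queerSubalgebra K n).toSubmodule
      fun x => (hΦ _).1 (LinearMap.mem_range_self ρ x)
  refine ⟨π, ⟨fun x y => Subtype.ext ?_, Superalgebra.map_mem_gr_of_parity fun x =>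
    queerVal_injective n ?_, ?_⟩, ?_⟩
  · change Φ (ρ (x * y)) = Φ (ρ x) * Φ (ρ y)
    rw [hmul, map_mul]
  · refine Eq.trans ?_ ((queerVal_parity n (π x)).trans (parity_matSuper n n (Φ (ρ x)))).symm
    change Φ (ρ (A.parity x)) = parityMatrix K n n * Φ (ρ x) * parityMatrix K n n
    rw [hpar, map_mul, map_mul, toMatrixAlgEquiv_parity b h₀ h₁]
  · rintro ⟨M, hM⟩
    obtain ⟨r, rfl⟩ := Φ.surjective M
    obtain ⟨x, rfl⟩ := (hΦ r).2 hM
    exact ⟨x, rfl⟩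
  · ext x
    exact Subtype.ext_iff.trans (map_eq_zero_iff Φ Φ.injective)

variable [FiniteDimensional K L]

/-- The image of a superalgebra in an irreducible graded representation is one of the simple
superalgebras `M_{r,s}(K)` and `Q_n(K)`. -/
theorem exists_quotientMap_of_irreducible [IsAlgClosed K] [NeZero (2 : K)] {g : Module.End K L}
    (hg : g * g = 1) (ρ : A →ₗ[K] Module.End K L) (hmul : ∀ x y, ρ (x * y) = ρ x * ρ y)
    (hpar : ∀ x, ρ (A.parity x) = g * ρ x * g) (hne : ρ ≠ 0)
    (hirr : ∀ U : Submodule K L, (∀ x ∈ U, g x ∈ U) → (∀ a, ∀ x ∈ U, ρ a x ∈ U) →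
      U = ⊥ ∨ U = ⊤) :
    (∃ r s, 1 ≤ r ∧ ∃ π : A →ₗ[K] matSuper K r s,
      IsQuotientMap π ∧ LinearMap.ker π = LinearMap.ker ρ) ∨
    ∃ n, 1 ≤ n ∧ ∃ π : A →ₗ[K] queerSuper K n,
      IsQuotientMap π ∧ LinearMap.ker π = LinearMap.ker ρ := by
  have hL : Nontrivial L := by
    by_contra h
    rw [not_nontrivial_iff_subsingleton] at h
    exact hne (LinearMap.ext fun x => Subsingleton.elim _ _)
  rcases eq_top_or_exists_centralizer g hg (LinearMap.range ρ)
    (by rintro _ ⟨x, rfl⟩ _ ⟨y, rfl⟩; exact ⟨x * y, hmul x y⟩)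
    (by rintro _ ⟨x, rfl⟩; exact ⟨A.parity x, hpar x⟩)
    (fun h => hne (LinearMap.range_eq_bot.1 h))
    (fun U h₁ h₂ => hirr U h₁ fun a => h₂ _ (LinearMap.mem_range_self ρ a)) with h | h
  · left
    have hsurj := LinearMap.range_eq_top.1 h
    obtain ⟨r, s, b, h₀, h₁⟩ := exists_basis_of_involution hg
    -- When `r = 0`, replacing `g` by `-g` leaves the conjugation unchanged and exchanges the
    -- blocks, so that `M_{0,s}` becomes `M_{s,0}`.
    rcases Nat.eq_zero_or_pos r with rfl | hr
    · refine ⟨s, 0, ?_, exists_map_matSuper (g := -g) (b.reindex (Equiv.sumComm _ _)) (fun i => ?_)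
        (fun j => ?_) ρ hmul (fun x => ?_) hsurj⟩
      · rw [Nat.one_le_iff_ne_zero]
        rintro rfl
        have := b.index_nonempty
        exact isEmptyElim this.some
      · simp [h₁]
      · simp [h₀]
      · rw [hpar, neg_mul, neg_mul_neg]
    · exact ⟨r, s, hr, exists_map_matSuper b h₀ h₁ ρ hmul hpar hsurj⟩
  · right
    obtain ⟨θ, hθ, hθg, hrange⟩ := h
    obtain ⟨n, b, h₀, h₁, hθ₀, hθ₁⟩ := exists_basis_of_anticommuting hg hθ hθg
    refine ⟨n, ?_, exists_map_queerSuper b h₀ h₁ hθ₀ hθ₁ ρ hmul hpar hrange⟩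
    rw [Nat.one_le_iff_ne_zero]
    rintro rfl
    have := b.index_nonempty
    exact isEmptyElim this.some

end Representations

/-! ### The one-dimensional null superalgebras. -/

/-- The line `K` with null product. -/
def NullLine (K : Type u) : Type u := K

instance : AddCommGroup (NullLine K) := inferInstanceAs (AddCommGroup K)

instance : Module K (NullLine K) := inferInstanceAs (Module K K)

instance : NonUnitalRing (NullLine K) where
  mul _ _ := 0
  left_distrib _ _ _ := (add_zero 0).symm
  right_distrib _ _ _ := (add_zero 0).symm
  zero_mul _ := rfl
  mul_zero _ := rfl
  mul_assoc _ _ _ := rfl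

/-- The one-dimensional superalgebra of degree `k` with null product. -/
def nullSuper (K : Type u) [Field K] (k : ZMod 2) : Superalgebra.{u, u} K where
  carrier := NullLine K
  tower := ⟨fun k _ _ => (smul_zero k).symm⟩
  comm := ⟨fun k _ _ => smul_zero k⟩
  finite := inferInstanceAs (FiniteDimensional K K)
  gr i := if i = k then ⊤ else ⊥
  isCompl := by
    have hz : ∀ k : ZMod 2, k = 0 ∨ k = 1 := by decide
    rcases hz k with rfl | rfl
    · rw [if_pos rfl, if_neg one_ne_zero]
      exact isCompl_top_bot
    · rw [if_pos rfl, if_neg zero_ne_one]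
      exact isCompl_bot_top
  mul_mem _ _ _ _ _ _ := zero_mem _

theorem mem_nullSuper_gr (k : ZMod 2) (x : nullSuper K k) : x ∈ (nullSuper K k).gr k := by
  have h : (nullSuper K k).gr k = ⊤ := if_pos rfl
  rw [h]
  exact Submodule.mem_top

theorem IsQuotientMap.mem_gr_iff [NeZero (2 : K)] {A : Superalgebra.{u, v} K}
    {V : Superalgebra.{u, w} K} {π : A →ₗ[K] V} (h : IsQuotientMap π)
    (hinj : Function.Injective π) (i : ZMod 2) (x : A) : x ∈ A.gr i ↔ π x ∈ V.gr i := by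
  have hz : ∀ k : ZMod 2, k = 0 ∨ k = 1 := by decide
  refine ⟨h.map_gr i x, fun hx => ?_⟩
  rcases hz i with rfl | rfl
  · rw [A.mem_gr_zero_iff, ← hinj.eq_iff, Superalgebra.parity_map h.map_gr,
      V.parity_of_mem_zero hx]
  · rw [A.mem_gr_one_iff, ← hinj.eq_iff, Superalgebra.parity_map h.map_gr,
      V.parity_of_mem_one hx, map_neg]

/-! ### Minimal graded ideals and the quotients by their orthogonals. -/

namespace OddSymmetricSuperalgebra

variable (A : OddSymmetricSuperalgebra.{u, v} K)

theorem exists_minimal_gradedIdeal [Nontrivial A] : ∃ I : Submodule K A, A.IsGradedIdeal I ∧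
    I ≠ ⊥ ∧ ∀ J, A.IsGradedIdeal J → J ≤ I → J = ⊥ ∨ J = I := by
  obtain ⟨I, ⟨hI, hne⟩, hmin⟩ := WellFounded.has_min (wellFounded_lt (α := Submodule K A))
    {I | A.IsGradedIdeal I ∧ I ≠ ⊥}
    ⟨⊤, ⟨fun _ _ => trivial, fun _ _ _ => trivial, fun _ _ _ => trivial⟩, top_ne_bot⟩
  refine ⟨I, hI, hne, fun J hJ hJI => or_iff_not_imp_left.2 fun hJ0 => ?_⟩
  exact hJI.eq_of_not_lt (hmin J ⟨hJ, hJ0⟩)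

theorem exists_minimal_gradedLeftIdeal {I : Submodule K A} (hI : A.IsGradedIdeal I) (hne : I ≠ ⊥) :
    ∃ L ≤ I, L ≠ ⊥ ∧ (∀ x ∈ L, A.parity x ∈ L) ∧ (∀ a, ∀ x ∈ L, a * x ∈ L) ∧
      ∀ U ≤ L, (∀ x ∈ U, A.parity x ∈ U) → (∀ a, ∀ x ∈ U, a * x ∈ U) → U = ⊥ ∨ U = L := by
  obtain ⟨L, ⟨hLI, h0, hp, hm⟩, hmin⟩ := WellFounded.has_min (wellFounded_lt (α := Submodule K A))
    {L | L ≤ I ∧ L ≠ ⊥ ∧ (∀ x ∈ L, A.parity x ∈ L) ∧ ∀ a, ∀ x ∈ L, a * x ∈ L}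
    ⟨I, le_rfl, hne, hI.parity_mem, hI.mul_left_mem⟩
  refine ⟨L, hLI, h0, hp, hm, fun U hUL hUp hUm => or_iff_not_imp_left.2 fun hU => ?_⟩
  exact hUL.eq_of_not_lt (hmin U ⟨hUL.trans hLI, hU, hUp, hUm⟩)

theorem orthogonal_orthogonal (I : Submodule K A) :
    A.form.orthogonal (A.form.orthogonal I) = I :=
  LinearMap.BilinForm.orthogonal_orthogonal A.nondegenerate A.isRefl_form I

theorem orthogonal_eq_top_iff {I : Submodule K A} : A.form.orthogonal I = ⊤ ↔ I = ⊥ := by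
  constructor
  · intro h
    rw [← A.orthogonal_orthogonal I, h]
    exact LinearMap.BilinForm.orthogonal_top_eq_bot A.nondegenerate
  · rintro rfl
    exact LinearMap.BilinForm.orthogonal_bot

theorem exists_homogeneous_ne_zero [NeZero (2 : K)] {I : Submodule K A} (hI : A.IsGradedIdeal I)
    (hne : I ≠ ⊥) : ∃ i, ∃ x ∈ I, x ∈ A.gr i ∧ x ≠ 0 := by
  obtain ⟨x, hx, hx0⟩ := Submodule.exists_mem_ne_zero_of_ne_bot hne
  -- The sum is twice the even component of `x`: either it is a nonzero even element of `I`, or `x`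
  -- itself is odd.
  by_cases h : x + A.parity x = 0
  · exact ⟨1, x, hx, A.mem_gr_one_iff.2 (eq_neg_of_add_eq_zero_right h), hx0⟩
  · refine ⟨0, _, add_mem hx (hI.parity_mem x hx), A.mem_gr_zero_iff.2 ?_, h⟩
    rw [map_add, A.parity_parity, add_comm]

/-- The quotient by the orthogonal of a minimal graded ideal with null action is a line with null
product. -/
theorem exists_map_nullSuper [NeZero (2 : K)] {I : Submodule K A} (hI : A.IsGradedIdeal I)
    (hne : I ≠ ⊥) (hmin : ∀ J, A.IsGradedIdeal J → J ≤ I → J = ⊥ ∨ J = I)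
    (hnull : ∀ a, ∀ x ∈ I, a * x = 0) :
    ∃ k, ∃ π : A →ₗ[K] nullSuper K k,
      IsQuotientMap π ∧ LinearMap.ker π = A.form.orthogonal I := by
  -- Cyclic invariance turns annihilation from the left into annihilation from the right, so every
  -- graded subspace of `I` is an ideal and minimality makes `I` a line.
  have hnull' : ∀ a, ∀ x ∈ I, x * a = 0 := fun a x hx => A.form_nondeg _ fun z => by
    rw [A.form_cyclic, hnull z x hx, map_zero, LinearMap.zero_apply]
  obtain ⟨i, x, hx, hxi, hx0⟩ := A.exists_homogeneous_ne_zero hI hne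
  have hspan : K ∙ x = I := by
    have hle : K ∙ x ≤ I := (Submodule.span_singleton_le_iff_mem _ _).2 hx
    refine (hmin _ ⟨fun y hy => ?_, fun a y hy => ?_, fun a y hy => ?_⟩ hle).resolve_left
      fun h => hx0 (Submodule.span_singleton_eq_bot.1 h)
    · obtain ⟨k, rfl⟩ := Submodule.mem_span_singleton.1 hy
      rw [map_smul]
      refine Submodule.smul_mem _ _ ?_
      have hz : ∀ k : ZMod 2, k = 0 ∨ k = 1 := by decide
      rcases hz i with rfl | rfl
      · rw [A.parity_of_mem_zero hxi]
        exact Submodule.mem_span_singleton_self x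
      · rw [A.parity_of_mem_one hxi]
        exact neg_mem (Submodule.mem_span_singleton_self x)
    · rw [hnull a y (hle hy)]
      exact zero_mem _
    · rw [hnull' a y (hle hy)]
      exact zero_mem _
  -- The target has degree `i + 1` because the odd form pairs `x`, of degree `i`, only with that
  -- degree.
  let π : A →ₗ[K] nullSuper K (i + 1) := (A.form x : A →ₗ[K] K)
  have hπ : ∀ a, π a = A.form x a := fun a => rfl
  refine ⟨i + 1, π, ⟨fun a b => ?_, fun j a ha => ?_, fun k => ?_⟩, ?_⟩
  · refine (A.form_assoc x a b).symm.trans ?_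
    rw [hnull' a x hx, map_zero]
    rfl
  · by_cases hj : j = i + 1
    · rw [hj]
      exact mem_nullSuper_gr _ _
    · have h2 : ∀ i j : ZMod 2, ¬ j = i + 1 → i + j = 0 := by decide
      have : π a = 0 := A.form_odd i j x a hxi ha (h2 i j hj)
      rw [this]
      exact zero_mem _
  · obtain ⟨a, ha⟩ : ∃ a, A.form x a ≠ 0 := by
      by_contra! h
      exact hx0 (A.form_nondeg x h)
    refine ⟨((show K from k) * (A.form x a)⁻¹) • a, ?_⟩
    refine (map_smul (A.form x) _ a).trans ?_
    exact inv_mul_cancel_right₀ ha _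
  · ext a
    rw [← hspan]
    change A.form x a = 0 ↔ ∀ y ∈ K ∙ x, A.form y a = 0
    refine ⟨fun h y hy => ?_, fun h => h x (Submodule.mem_span_singleton_self x)⟩
    obtain ⟨k, rfl⟩ := Submodule.mem_span_singleton.1 hy
    rw [map_smul, LinearMap.smul_apply, h, smul_zero]

/-- The quotient by the orthogonal of a minimal graded ideal with non-null action is one of the
superalgebras `M_{r,s}(K)` and `Q_n(K)`. -/
theorem exists_map_simple [IsAlgClosed K] [NeZero (2 : K)] {I : Submodule K A}
    (hI : A.IsGradedIdeal I)
    (hne : I ≠ ⊥) (hmin : ∀ J, A.IsGradedIdeal J → J ≤ I → J = ⊥ ∨ J = I)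
    (hnull : ¬ ∀ a, ∀ x ∈ I, a * x = 0) :
    (∃ r s, 1 ≤ r ∧ ∃ π : A →ₗ[K] matSuper K r s,
      IsQuotientMap π ∧ LinearMap.ker π = A.form.orthogonal I) ∨
    ∃ n, 1 ≤ n ∧ ∃ π : A →ₗ[K] queerSuper K n,
      IsQuotientMap π ∧ LinearMap.ker π = A.form.orthogonal I := by
  have hfaithful : ∀ x ∈ I, (∀ a, a * x = 0) → x = 0 := by
    -- The elements of `I` killed by all left multiplications form a graded ideal, which minimality
    -- and `hnull` force to be zero.
    let Z : Submodule K A :=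
      { carrier := {x | x ∈ I ∧ ∀ a, a * x = 0}
        add_mem' := fun {x y} hx hy => ⟨add_mem hx.1 hy.1, fun a => by
          rw [mul_add, hx.2, hy.2, add_zero]⟩
        zero_mem' := ⟨zero_mem _, fun a => mul_zero a⟩
        smul_mem' := fun k x hx => ⟨I.smul_mem k hx.1, fun a => by
          rw [mul_smul_comm, hx.2, smul_zero]⟩ }
    have hZ : A.IsGradedIdeal Z :=
      { parity_mem := fun x hx => ⟨hI.parity_mem x hx.1, fun a => by
          rw [← A.parity_parity a, ← A.parity_mul, hx.2, map_zero]⟩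
        mul_left_mem := fun a x hx => by
          rw [hx.2]
          exact zero_mem _
        mul_right_mem := fun a x hx => ⟨hI.mul_right_mem a x hx.1, fun b => by
          rw [← mul_assoc, hx.2, zero_mul]⟩ }
    rcases hmin Z hZ fun x hx => hx.1 with h | h
    · intro x hx hx'
      have : x ∈ Z := ⟨hx, hx'⟩
      rwa [h, Submodule.mem_bot] at this
    · refine absurd (fun a x hx => ?_) hnull
      rw [← h] at hx
      exact hx.2 a
  obtain ⟨L, hLI, hL0, hLp, hLm, hLmin⟩ := A.exists_minimal_gradedLeftIdeal hI hne
  let g : Module.End K L := A.parity.restrict hLp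
  let ρ : A →ₗ[K] Module.End K L :=
    LinearMap.mk₂ K (fun a (x : L) => (⟨a * x, hLm a x x.2⟩ : L))
      (fun a b x => Subtype.ext (add_mul a b x.1))
      (fun k a x => Subtype.ext (smul_mul_assoc k a x.1))
      (fun a x y => Subtype.ext (mul_add a x.1 y.1))
      (fun k a x => Subtype.ext (mul_smul_comm k a x.1))
  have hρ : ∀ a (x : L), (ρ a x : A) = a * x := fun a x => rfl
  have mem_ker : ∀ a, a ∈ LinearMap.ker ρ ↔ ∀ x ∈ L, a * x = 0 := fun a => by
    rw [LinearMap.mem_ker]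
    refine ⟨fun h x hx => ?_, fun h => LinearMap.ext fun x => Subtype.ext (h x x.2)⟩
    rw [← hρ a ⟨x, hx⟩, h]
    rfl
  have hker0 : LinearMap.ker ρ ≠ ⊤ := fun h => by
    obtain ⟨x, hx, hx0⟩ := Submodule.exists_mem_ne_zero_of_ne_bot hL0
    refine hx0 (hfaithful x (hLI hx) fun a => (mem_ker a).1 ?_ x hx)
    rw [h]
    exact Submodule.mem_top
  have hkerI : A.IsGradedIdeal (LinearMap.ker ρ) :=
    { parity_mem := fun a ha => (mem_ker _).2 fun x hx => by
        rw [← A.parity_parity x, ← A.parity_mul, (mem_ker a).1 ha _ (hLp x hx), map_zero]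
      mul_left_mem := fun b a ha => (mem_ker _).2 fun x hx => by
        rw [mul_assoc, (mem_ker a).1 ha x hx, mul_zero]
      mul_right_mem := fun b a ha => (mem_ker _).2 fun x hx => by
        rw [mul_assoc, (mem_ker a).1 ha _ (hLm b x hx)] }
  -- For `a` in `I^⊥` and `x` in `L`, `B(a x, z) = B(a, x z)` vanishes because `x z` lies in `I`.
  have hle : A.form.orthogonal I ≤ LinearMap.ker ρ := fun a ha => (mem_ker a).2 fun x hx =>
    A.form_nondeg _ fun z => by
      rw [A.form_assoc, A.form_symm]
      exact ha _ (hI.mul_right_mem z x (hLI hx))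
  have hker : LinearMap.ker ρ = A.form.orthogonal I := by
    have hle' : A.form.orthogonal (LinearMap.ker ρ) ≤ I := by
      conv_rhs => rw [← A.orthogonal_orthogonal I]
      exact LinearMap.BilinForm.orthogonal_le hle
    -- The orthogonal of `ker ρ` is a graded ideal inside `I`. It is nonzero because `A` acts
    -- nontrivially on `L`, so it is `I`.
    rcases hmin _ (A.isGradedIdeal_orthogonal hkerI) hle' with h | h
    · refine absurd ?_ hker0
      rw [← A.orthogonal_orthogonal (LinearMap.ker ρ), A.orthogonal_eq_top_iff, h]
    · rw [← h, A.orthogonal_orthogonal]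
  rw [← hker]
  refine exists_quotientMap_of_irreducible (g := g) ?_ ρ (fun a b => ?_) (fun a => ?_) ?_
    (fun U hUg hUρ => ?_)
  · exact LinearMap.ext fun x => Subtype.ext (A.parity_parity x)
  · exact LinearMap.ext fun x => Subtype.ext (mul_assoc a b x)
  · refine LinearMap.ext fun x => Subtype.ext ?_
    change A.parity a * x = A.parity (a * A.parity x)
    rw [A.parity_mul, A.parity_parity]
  · intro h
    exact hker0 (LinearMap.ker_eq_top.2 h)
  · have h₁ : ∀ x ∈ U.map L.subtype, A.parity x ∈ U.map L.subtype := by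
      rintro _ ⟨x, hx, rfl⟩
      exact ⟨g x, hUg x hx, rfl⟩
    have h₂ : ∀ a, ∀ x ∈ U.map L.subtype, a * x ∈ U.map L.subtype := by
      rintro a _ ⟨x, hx, rfl⟩
      exact ⟨ρ a x, hUρ a x hx, rfl⟩
    rcases hLmin _ (Submodule.map_subtype_le L U) h₁ h₂ with h | h
    · exact Or.inl (Submodule.map_injective_of_injective L.injective_subtype
        (h.trans (Submodule.map_bot _).symm))
    · exact Or.inr (Submodule.map_injective_of_injective L.injective_subtype
        (h.trans (Submodule.map_subtype_top L).symm))

/-- An odd-symmetric superalgebra is a generalized double extension of a smaller one by its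
quotient by the orthogonal of an isotropic graded ideal. -/
theorem exists_isomorphic_doubleExtension [NeZero (2 : K)] {I : Submodule K A} (hne : I ≠ ⊥)
    (hiso : I ≤ A.form.orthogonal I) {V : Superalgebra.{u, w} K} {π : A →ₗ[K] V}
    (hπ : IsQuotientMap π) (hker : LinearMap.ker π = A.form.orthogonal I) :
    ∃ (W : OddSymmetricSuperalgebra.{u, v} K) (c : DoubleExtensionContext W V),
      A.Isomorphic c.doubleExtension ∧ Module.finrank K W < Module.finrank K A := by
  obtain ⟨d⟩ := A.exists_splitting π hπ.map_mul hπ.map_gr hπ.surjective (by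
    rwa [hker, A.orthogonal_orthogonal])
  refine ⟨d.reduction, d.context, d.isomorphic, d.finrank_reduction_lt ?_⟩
  rw [Module.finrank_pos_iff]
  by_contra h
  rw [not_nontrivial_iff_subsingleton] at h
  -- If `V` were zero, `I^⊥` would be all of `A` and `I` would be zero; so the reduction is strictly
  -- smaller.
  refine hne (A.orthogonal_eq_top_iff.1 ?_)
  rw [← hker, LinearMap.ker_eq_top]
  exact LinearMap.ext fun x => Subsingleton.elim _ _

/-! ### Exclusion of `M_{r,s}` and of the null lines. -/

/-- No odd-symmetric superalgebra is isomorphic to `M_{r,s}(K)`, unless it is zero. -/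
theorem eq_zero_of_bijective_matSuper [NeZero (2 : K)] {r s : ℕ} {π : A →ₗ[K] matSuper K r s}
    (hπ : IsQuotientMap π) (hinj : Function.Injective π) (x : A) : x = 0 := by
  let e : A ≃ₗ[K] Matrix (Fin r ⊕ Fin s) (Fin r ⊕ Fin s) K :=
    LinearEquiv.ofBijective π ⟨hinj, hπ.surjective⟩
  have he : ∀ M N, e.symm (M * N) = e.symm M * e.symm N := fun M N => e.injective <| by
    refine (e.apply_symm_apply _).trans (Eq.trans ?_ (hπ.map_mul _ _).symm)
    change M * N = e (e.symm M) * e (e.symm N)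
    rw [e.apply_symm_apply, e.apply_symm_apply]
  have hgr : ∀ M, M ∈ matGr K r s 0 → e.symm M ∈ A.gr 0 := fun M hM =>
    (hπ.mem_gr_iff hinj 0 _).2 (by
      change e (e.symm M) ∈ matGr K r s 0
      rwa [e.apply_symm_apply])
  have hu : e.symm 1 ∈ A.gr 0 := hgr 1 (mem_matGr_zero.2 ⟨Matrix.ext fun i j => by
    simp [Matrix.toBlocks₁₂], Matrix.ext fun i j => by simp [Matrix.toBlocks₂₁]⟩)
  -- The form is `B(M, N) = f(M N)` with `f = B(·, 1)`. Diagonal matrix units are even, like `1`, so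
  -- `f` kills them by oddness; the off-diagonal ones are commutators.
  let f : Matrix (Fin r ⊕ Fin s) (Fin r ⊕ Fin s) K →ₗ[K] K := A.form.flip (e.symm 1) ∘ₗ e.symm
  have f_mul : ∀ M N, f (M * N) = A.form (e.symm M) (e.symm N) := fun M N => by
    change A.form (e.symm (M * N)) (e.symm 1) = _
    rw [he, A.form_assoc, ← he, mul_one]
  have f_comm : ∀ M N, f (M * N) = f (N * M) := fun M N => by
    rw [f_mul, f_mul, A.form_symm]
  have f_single : ∀ i j, f (Matrix.single i j 1) = 0 := fun i j => by
    by_cases hij : i = j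
    · subst hij
      refine A.form_odd 0 0 _ _ (hgr _ (mem_matGr_zero.2 ?_)) hu rfl
      rcases i with i | i <;> constructor <;> ext a b <;>
        simp [Matrix.toBlocks₁₂, Matrix.toBlocks₂₁]
    · have h := f_comm (Matrix.single i i 1) (Matrix.single i j 1)
      rw [Matrix.single_mul_single_same, Matrix.single_mul_single_of_ne _ _ _ _ (Ne.symm hij),
        map_zero, one_mul] at h
      exact h
  have f_zero : ∀ M, f M = 0 := fun M => by
    rw [Matrix.matrix_eq_sum_single M, map_sum]
    refine Finset.sum_eq_zero fun i _ => ?_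
    rw [map_sum]
    refine Finset.sum_eq_zero fun j _ => ?_
    rw [← mul_one (M i j), ← smul_eq_mul, ← Matrix.smul_single, map_smul, f_single, smul_zero]
  refine A.form_nondeg x fun y => ?_
  rw [← e.symm_apply_apply x, ← e.symm_apply_apply y, ← f_mul, f_zero]

/-- All of `A` would be homogeneous of degree `k`, and an odd form vanishes between elements of
equal degree. -/
theorem eq_zero_of_bijective_nullSuper [NeZero (2 : K)] {k : ZMod 2} {π : A →ₗ[K] nullSuper K k}
    (hπ : IsQuotientMap π) (hinj : Function.Injective π) (x : A) : x = 0 := by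
  have h : ∀ y, y ∈ A.gr k := fun y => (hπ.mem_gr_iff hinj k y).2 (mem_nullSuper_gr _ _)
  have h2 : ∀ k : ZMod 2, k + k = 0 := by decide
  exact A.form_nondeg x fun y => A.form_odd k k x y (h x) (h y) (h2 k)

theorem finrank_ofIdeal [NeZero (2 : K)] {I : Submodule K A} (hI : A.IsGradedIdeal I)
    (hd : Disjoint I (A.form.orthogonal I)) :
    Module.finrank K (A.ofIdeal hI hd) = Module.finrank K I := rfl

end OddSymmetricSuperalgebra

/-! ### The induction on dimension. -/

theorem obtained_of_finrank [IsAlgClosed K] [CharZero K] (n : ℕ) :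
    ∀ A : OddSymmetricSuperalgebra.{u, v} K, Module.finrank K A = n → Obtained A := by
  induction n using Nat.strong_induction_on with
  | h n ih =>
  rintro A rfl
  have ih' : ∀ W : OddSymmetricSuperalgebra.{u, v} K,
      Module.finrank K W < Module.finrank K A → Obtained W := fun W hW => ih _ hW W rfl
  rcases subsingleton_or_nontrivial A with hA | hA
  · exact Obtained.zero A fun x => Subsingleton.elim _ _
  obtain ⟨I, hI, hne, hmin⟩ := A.exists_minimal_gradedIdeal
  have hI' := A.isGradedIdeal_orthogonal hI
  have hinf : A.IsGradedIdeal (I ⊓ A.form.orthogonal I) :=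
    ⟨fun x hx => ⟨hI.parity_mem x hx.1, hI'.parity_mem x hx.2⟩,
      fun a x hx => ⟨hI.mul_left_mem a x hx.1, hI'.mul_left_mem a x hx.2⟩,
      fun a x hx => ⟨hI.mul_right_mem a x hx.1, hI'.mul_right_mem a x hx.2⟩⟩
  rcases hmin _ hinf inf_le_left with h | h
  · have hd : Disjoint I (A.form.orthogonal I) := disjoint_iff.2 h
    by_cases htop : I = ⊤
    -- Here `I^⊥ = 0`, so the quotient map is an isomorphism from `A` onto a null line, some
    -- `M_{r,s}` or some `Q_n`, and only the last can occur.
    · have hbot : A.form.orthogonal I = ⊥ := by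
        rw [htop]
        exact LinearMap.BilinForm.orthogonal_top_eq_bot A.nondegenerate
      obtain ⟨x, hx⟩ := exists_ne (0 : A)
      by_cases hnull : ∀ a, ∀ x ∈ I, a * x = 0
      · obtain ⟨k, π, hπ, hker⟩ := A.exists_map_nullSuper hI hne hmin hnull
        rw [hbot, LinearMap.ker_eq_bot] at hker
        exact absurd (A.eq_zero_of_bijective_nullSuper hπ hker x) hx
      · rcases A.exists_map_simple hI hne hmin hnull with
          ⟨r, s, hr, π, hπ, hker⟩ | ⟨n, hn, π, hπ, hker⟩
        · rw [hbot, LinearMap.ker_eq_bot] at hker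
          exact absurd (A.eq_zero_of_bijective_matSuper hπ hker x) hx
        · rw [hbot, LinearMap.ker_eq_bot] at hker
          exact Obtained.queer A n hn ⟨LinearEquiv.ofBijective π ⟨hker, hπ.surjective⟩,
            hπ.map_mul, hπ.mem_gr_iff hker⟩
    · have hd' : Disjoint (A.form.orthogonal I)
          (A.form.orthogonal (A.form.orthogonal I)) := by
        rw [A.orthogonal_orthogonal]
        exact hd.symm
      have hcompl : IsCompl I (A.form.orthogonal I) :=
        (LinearMap.BilinForm.isCompl_orthogonal_iff_disjoint A.isRefl_form).2 hd
      refine Obtained.orthSum A _ _ (ih' (A.ofIdeal hI hd) ?_) (ih' (A.ofIdeal hI' hd') ?_)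
        (A.isomorphic_orthSum hI hd hI' hd' hcompl fun x hx y hy => hy x hx)
      · rw [A.finrank_ofIdeal]
        exact Submodule.finrank_lt htop
      · rw [A.finrank_ofIdeal]
        exact Submodule.finrank_lt fun h => hne (A.orthogonal_eq_top_iff.1 h)
  · have hiso : I ≤ A.form.orthogonal I := inf_eq_left.1 h
    by_cases hnull : ∀ a, ∀ x ∈ I, a * x = 0
    · obtain ⟨k, π, hπ, hker⟩ := A.exists_map_nullSuper hI hne hmin hnull
      obtain ⟨W, c, hc, hW⟩ := A.exists_isomorphic_doubleExtension hne hiso hπ hker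
      exact Obtained.extNull A W (nullSuper K k) (Module.finrank_self K) (fun _ _ => rfl) c
        (ih' W hW) hc
    · rcases A.exists_map_simple hI hne hmin hnull with
        ⟨r, s, hr, π, hπ, hker⟩ | ⟨n, hn, π, hπ, hker⟩
      · obtain ⟨W, c, hc, hW⟩ := A.exists_isomorphic_doubleExtension hne hiso hπ hker
        exact Obtained.extMat A W r s hr c (ih' W hW) hc
      · obtain ⟨W, c, hc, hW⟩ := A.exists_isomorphic_doubleExtension hne hiso hπ hker
        exact Obtained.extQueer A W n hn c (ih' W hW) hc

end OddSym

end

theorem mainTheorem4 (K : Type u) [Field K] [IsAlgClosed K] [CharZero K]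
    (A : OddSym.OddSymmetricSuperalgebra.{u, v} K) : OddSym.Obtained A :=
  OddSym.obtained_of_finrank _ A rfl
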